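/- **Setting.** Let $\ell^2=\ell^2(\mathbb Z;\mathbb R)$ and let $C_b(\mathbb R,\ell^2)$ be the bounded continuous functions with the supremum norm. Let $\{\omega\in C(\mathbb R,\mathbb R):\omega(0)=0\}$ carry the compact-open topology, its Borel $\sigma$-algebra, the two-sided Wiener measure $P$ and the Wiener shift $\theta_t\omega(\cdot)=\omega(\cdot+t)-\omega(t)$. Let $\Omega$ be the set of those $\omega$ with $|\omega(t)|/|t|\to0$ as $t\to\pm\infty$, with the trace $\sigma$-algebra $\mathcal F$ and the restriction of $P$, and put $z(\omega)=-\int_{-\infty}^0 e^{r}\omega(r)\,dr$. For coefficients $\nu_i,\lambda_i:\mathbb R\to\mathbb R$, nonlinearities $f_i(x,t)$ ($i\in\mathbb Z$), and $g=(g_i)_{i\in\mathbb Z}$ consider $$\frac{dv_i}{dt}=G_i(v,t,\theta_t\omega):=-\nu_i(t)(-v_{i-1}+2v_i-v_{i+1})-\lambda_i(t)v_i-e^{-z(\theta_t\omega)}f_i(e^{z(\theta_t\omega)}v_i,t)+e^{-z(\theta_t\omega)}g_i(t)+z(\theta_t\omega)v_i,\quad v(\tau)=v_\tau .\tag{1}$$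 For $I=[\tau,\tau+T)$ with $T>0$, or $I=[\tau,\infty)$, a mild solution of (1) on $I$ is a $v\in C(I,\ell^2)$ with $v(\tau)=v_\tau$ such that, for all $i\in\mathbb Z$ and $t\in I$, $s\mapsto G_i(v(s),s,\theta_s\omega)$ is integrable on $[\tau,t]$ and $v_i(t)=v_i(\tau)+\int_\tau^tG_i(v(s),s,\theta_s\omega)\,ds$. **Assumptions.** (A1) $\nu_i,\lambda_i\in L^1_{loc}(\mathbb R)$, and there are positive constants with $\lambda_0\le\lambda_i(t)\le\lambda^0$ and $\nu_0\le\nu_i(t)\le\nu^0$ for all $i,t$. (A2) $f_i\in C(\mathbb R\times\mathbb R,\mathbb R)$ is differentiable in $x$, $f_i(0,t)=0$, $xf_i(x,t)\ge-\alpha_i(t)^2$ for some $\alpha=(\alpha_i)_{i\in\mathbb Z}\in C_b(\mathbb R,\ell^2)$, and $\partial_xf_i(x,t)\ge-\beta$ for some constant $\beta\ge0$, for all $x,t,i$. (A3) There is a continuous $\zeta:[0,\infty)\times\mathbb R\to(0,\infty)$ with $|\partial_xf_i(x,t)|\le\zeta(r,t)$ for all $r\ge0$, $|x|\le r$, $t\in\mathbb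 R$, $i\in\mathbb Z$. (A4) $g\in C_b(\mathbb R,\ell^2)$. **Proposition.** Let (A1)–(A4) hold. The set $\Omega$ is measurable with $P(\Omega)=1$, and for $\omega\in\Omega$ the integral defining $z(\omega)$ converges and $t\mapsto z(\theta_t\omega)$ is continuous. For all $\tau\in\mathbb R$, $\omega\in\Omega$, $v_\tau\in\ell^2$ and $g\in C_b(\mathbb R,\ell^2)$, problem (1) has a mild solution $v(\cdot,\tau;\omega,v_\tau,g)$ on $[\tau,\infty)$; it is the unique mild solution on $[\tau,\infty)$, and its restriction to $[\tau,\tau+T)$ is the unique mild solution there, for every $T>0$. For all $t\ge\tau$, the map $\omega\mapsto v(t,\tau;\omega,v_\tau,g)$ is $(\mathcal F,\mathcal B(\ell^2))$-measurable and the map $(v_\tau,g)\mapsto v(t,\tau;\omega,v_\tau,g)$ is continuous from $\ell^2\times C_b(\mathbb R,\ell^2)$ to $\ell^2$. Moreover, for every such $g$, $$\Phi(t,\tau,\omega,v_\tau)=v(t+\tau,\tau;\theta_{-\tau}\omega,v_\tau,g),\qquad t\ge0,$$ is a continuous cocycle on $\ell^2$ over $\mathbb R$ with the shifts $\theta_{1,s}\tau=\tau+s$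 and over $(\Omega,\mathcal F,P,\{\theta_t\}_{t\in\mathbb R})$. That is: $\{\theta_{1,s}\}$ and $\{\theta_t\}$ are groups of maps; $P$ is a probability measure on $\Omega$, $(t,\omega)\mapsto\theta_t\omega$ is measurable and each $\theta_t$ preserves $P$; for each $\tau$ the map $(t,\omega,x)\mapsto\Phi(t,\tau,\omega,x)$ is measurable on $[0,\infty)\times\Omega\times\ell^2$; $\Phi(0,\tau,\omega,\cdot)$ is the identity; $\Phi(t+s,\tau,\omega,x)=\Phi(t,\tau+s,\theta_s\omega,\Phi(s,\tau,\omega,x))$ for $t,s\ge0$; and each $\Phi(t,\tau,\omega,\cdot)$ is continuous. Finally, with $u(t,\tau;\omega,u_\tau,g):=e^{z(\theta_t\omega)}v(t,\tau;\omega,e^{-z(\theta_\tau\omega)}u_\tau,g)$, one has $\Phi(t,\tau,\omega,e^{-z(\omega)}u_\tau)=e^{-z(\theta_t\omega)}u(t+\tau,\tau;\theta_{-\tau}\omega,u_\tau,g)$. -/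

import Mathlib

open MeasureTheory ProbabilityTheory Filter Topology Set
open scoped NNReal BoundedContinuousFunction

namespace LatticeRDE

noncomputable section

/-! ### Cocycles over two parametric spaces -/

/-- A group of self-maps `θ_t`, `t ∈ ℝ`, of a set. -/
structure IsGroupOfMaps {Ω : Type*} (θ : ℝ → Ω → Ω) : Prop where
  zero : ∀ ω, θ 0 ω = ω
  add : ∀ s t ω, θ (s + t) ω = θ t (θ s ω)

/-- `(Ω, 𝓕, P, θ)` is a parametric (measure preserving) dynamical system. -/
structure IsMetricDS {Ω : Type*} [MeasurableSpace Ω] (θ : ℝ → Ω → Ω) (P : Measure Ω) : Prop where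
  prob : IsProbabilityMeasure P
  group : IsGroupOfMaps θ
  measurable : Measurable (fun p : ℝ × Ω => θ p.1 p.2)
  invariant : ∀ t, P.map (θ t) = P

/-- `Φ` is a continuous cocycle on `X` over the parametric dynamical systems `(Ω₁, θ₁)` and
`(Ω₂, 𝓕₂, P, θ₂)`. -/
structure IsContinuousCocycle {Ω₁ Ω₂ X : Type*} [Nonempty Ω₁] [MeasurableSpace Ω₂]
    [TopologicalSpace X] [MeasurableSpace X] [BorelSpace X]
    (θ₁ : ℝ → Ω₁ → Ω₁) (θ₂ : ℝ → Ω₂ → Ω₂) (P : Measure Ω₂)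
    (Φ : ℝ≥0 → Ω₁ → Ω₂ → X → X) : Prop where
  base₁ : IsGroupOfMaps θ₁
  base₂ : IsMetricDS θ₂ P
  measurable : ∀ ω₁, Measurable (fun p : ℝ≥0 × Ω₂ × X => Φ p.1 ω₁ p.2.1 p.2.2)
  zero : ∀ ω₁ ω₂ x, Φ 0 ω₁ ω₂ x = x
  cocycle : ∀ t s ω₁ ω₂ x, Φ (t + s) ω₁ ω₂ x = Φ t (θ₁ s ω₁) (θ₂ s ω₂) (Φ s ω₁ ω₂ x)
  continuous : ∀ t ω₁ ω₂, Continuous (Φ t ω₁ ω₂)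

/-! ### The state space `ℓ²` -/

/-- The Hilbert space of real square summable families indexed by `ℤ`. -/
abbrev EllTwo : Type := ↥(lp (fun _ : ℤ => ℝ) 2)

instance : MeasurableSpace EllTwo := borel EllTwo

instance : BorelSpace EllTwo := ⟨rfl⟩

/-! ### The Wiener space, the Wiener shift and the Ornstein–Uhlenbeck variable -/

/-- Two-sided continuous real paths that vanish at `0`, with the compact-open topology and its
Borel σ-algebra. -/
abbrev PathSpace : Type := {ω : C(ℝ, ℝ) // ω 0 = 0}

instance : MeasurableSpace PathSpace := borel PathSpace

instance : BorelSpace PathSpace := ⟨rfl⟩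

/-- The law of two-sided Brownian motion: the increments of the coordinate process are independent
and the increment between `s` and `t` is centred Gaussian with variance `|t - s|`. -/
structure IsWienerMeasure (P : Measure PathSpace) : Prop where
  indep : HasIndepIncrements (fun (t : ℝ) (ω : PathSpace) => ω.1 t) P
  law : ∀ s t : ℝ, HasLaw (fun ω : PathSpace => ω.1 t - ω.1 s) (gaussianReal 0 (nndist s t)) P

/-- The Wiener shift `(θ_t ω)(s) = ω(s + t) - ω(t)`. -/
def wienerShift (t : ℝ) (ω : PathSpace) : PathSpace :=
  ⟨⟨fun s => ω.1 (s + t) - ω.1 t, by fun_prop⟩, by simp⟩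

/-- The paths of sublinear growth, `|ω(t)| / |t| → 0` as `t → ±∞`. -/
def temperedPaths : Set PathSpace :=
  {ω | Tendsto (fun t => |ω.1 t| / |t|) atTop (𝓝 0) ∧
    Tendsto (fun t => |ω.1 t| / |t|) atBot (𝓝 0)}

lemma tendsto_shift_aux {l : Filter ℝ} {h : ℝ → ℝ} {t : ℝ}
    (hl : Tendsto (fun s : ℝ => |s|) l atTop) (hs : Tendsto (fun s : ℝ => s + t) l l)
    (hh : Tendsto (fun s => |h s| / |s|) l (𝓝 0)) :
    Tendsto (fun s => |h (s + t) - h t| / |s|) l (𝓝 0) := by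
  have hinv : Tendsto (fun s : ℝ => |s|⁻¹) l (𝓝 0) := tendsto_inv_atTop_zero.comp hl
  have hh' : Tendsto (fun s => |h (s + t)| / |s + t|) l (𝓝 0) := hh.comp hs
  have hbound : Tendsto
      (fun s => |h (s + t)| / |s + t| * (1 + |t| * |s|⁻¹) + |h t| * |s|⁻¹) l (𝓝 0) := by
    simpa using (hh'.mul ((hinv.const_mul |t|).const_add 1)).add (hinv.const_mul |h t|)
  have hne : ∀ᶠ s in l, s ≠ 0 := by
    filter_upwards [hl.eventually_gt_atTop 0] with s h0 using abs_pos.1 h0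
  have hne' : ∀ᶠ s in l, s + t ≠ 0 := hs.eventually hne
  refine squeeze_zero' (Eventually.of_forall fun s => by positivity) ?_ hbound
  filter_upwards [hne, hne'] with s h0 h1
  have p0 : 0 < |s| := abs_pos.2 h0
  have p1 : 0 < |s + t| := abs_pos.2 h1
  have e1 : |h (s + t)| ≤ |h (s + t)| / |s + t| * (|s| + |t|) := by
    rw [div_mul_eq_mul_div, le_div_iff₀ p1]
    exact mul_le_mul_of_nonneg_left (abs_add_le s t) (abs_nonneg _)
  have e2 : |h (s + t) - h t| ≤ |h (s + t)| / |s + t| * (|s| + |t|) + |h t| :=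
    (abs_sub _ _).trans (add_le_add e1 le_rfl)
  rw [div_le_iff₀ p0]
  refine e2.trans (le_of_eq ?_)
  field_simp

lemma wienerShift_mem (t : ℝ) {ω : PathSpace} (hω : ω ∈ temperedPaths) :
    wienerShift t ω ∈ temperedPaths :=
  ⟨tendsto_shift_aux tendsto_abs_atTop_atTop (tendsto_atTop_add_const_right _ t tendsto_id) hω.1,
    tendsto_shift_aux tendsto_abs_atBot_atTop (tendsto_atBot_add_const_right _ t tendsto_id) hω.2⟩

/-- The paths of sublinear growth as a measurable space of their own (trace σ-algebra). -/
abbrev Tempered : Type := ↥temperedPaths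

/-- The Wiener shift on the paths of sublinear growth. -/
def shift (t : ℝ) (ω : Tempered) : Tempered := ⟨wienerShift t ω.1, wienerShift_mem t ω.2⟩

/-- The stationary Ornstein–Uhlenbeck variable `z(ω) = -∫_{-∞}^0 e^r ω(r) dr`. -/
def ouZ (ω : Tempered) : ℝ := -∫ r in Iic (0 : ℝ), Real.exp r * ω.1.1 r

/-! ### The random lattice equation -/

/-- Assumption (A1) on `ν` and `λ`. -/
def AssumptionA1 (ν lam : ℤ → ℝ → ℝ) : Prop :=
  (∀ i, LocallyIntegrable (ν i)) ∧ (∀ i, LocallyIntegrable (lam i)) ∧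
  (∃ l₀ l₁ : ℝ, 0 < l₀ ∧ 0 < l₁ ∧ ∀ i t, l₀ ≤ lam i t ∧ lam i t ≤ l₁) ∧
  (∃ n₀ n₁ : ℝ, 0 < n₀ ∧ 0 < n₁ ∧ ∀ i t, n₀ ≤ ν i t ∧ ν i t ≤ n₁)

/-- Assumption (A2) on the nonlinearities `f i x t`, with the joint continuity of every `f i`. -/
def AssumptionA2 (f : ℤ → ℝ → ℝ → ℝ) : Prop :=
  (∀ i, Continuous (fun p : ℝ × ℝ => f i p.1 p.2)) ∧
  (∀ i t, Differentiable ℝ (fun x => f i x t)) ∧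
  (∀ i t, f i 0 t = 0) ∧
  (∃ α : ℝ →ᵇ EllTwo, ∀ i x t, -(α t i) ^ 2 ≤ x * f i x t) ∧
  (∃ β : ℝ, 0 ≤ β ∧ ∀ i x t, -β ≤ deriv (fun y => f i y t) x)

/-- Assumption (A3): local bounds on `∂ₓ f i`, uniform in `i`. -/
def AssumptionA3 (f : ℤ → ℝ → ℝ → ℝ) : Prop :=
  ∃ ζ : ℝ → ℝ → ℝ, ContinuousOn (fun p : ℝ × ℝ => ζ p.1 p.2) (Ici 0 ×ˢ univ) ∧
    (∀ r, 0 ≤ r → ∀ t, 0 < ζ r t) ∧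
    ∀ r, 0 ≤ r → ∀ t i, ∀ x ∈ Icc (-r) r, |deriv (fun y => f i y t) x| ≤ ζ r t

/-- The components of the right-hand side
`G(v, t, ω) = -ν(t) A v - λ(t) v - e^{-z(ω)} f(e^{z(ω)} v, t) + e^{-z(ω)} g(t) + z(ω) v`, where
`(A v)_i = -v_{i-1} + 2 v_i - v_{i+1}`. -/
def latticeField (ν lam : ℤ → ℝ → ℝ) (f : ℤ → ℝ → ℝ → ℝ) (g : ℝ →ᵇ EllTwo)
    (v : EllTwo) (t : ℝ) (ω : Tempered) (i : ℤ) : ℝ :=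
  -ν i t * (-v (i - 1) + 2 * v i - v (i + 1)) - lam i t * v i
    - Real.exp (-ouZ ω) * f i (Real.exp (ouZ ω) * v i) t
    + Real.exp (-ouZ ω) * g t i + ouZ ω * v i

/-- `v` is a mild solution of `dv/dt = G(v, t, θ_t ω)`, `v(τ) = v₀`, on the interval `I`
(either `[τ, τ + T)` or `[τ, ∞)`): `v ∈ C(I, ℓ²)` and the integral equation holds in every
component. Only the values of `v` on `I` matter. -/
def IsMildSolution (G : EllTwo → ℝ → Tempered → ℤ → ℝ) (τ : ℝ) (ω : Tempered) (v₀ : EllTwo)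
    (I : Set ℝ) (v : ℝ → EllTwo) : Prop :=
  ContinuousOn v I ∧ v τ = v₀ ∧ ∀ t ∈ I, ∀ i : ℤ,
    IntervalIntegrable (fun s => G (v s) s (shift s ω) i) volume τ t ∧
    v t i = v τ i + ∫ s in τ..t, G (v s) s (shift s ω) i

/-- The solution `u(t, τ; ω, u_τ, g)` in the original variable that belongs to a solution map
`v(t, τ; ω, v_τ, g)`: `u(t) = e^{z(θ_t ω)} v(t)` with `v_τ = e^{-z(θ_τ ω)} u_τ`. -/
def originalSolution (v : ℝ → ℝ → Tempered → EllTwo → (ℝ →ᵇ EllTwo) → EllTwo)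
    (t τ : ℝ) (ω : Tempered) (u₀ : EllTwo) (g : ℝ →ᵇ EllTwo) : EllTwo :=
  Real.exp (ouZ (shift t ω)) • v t τ ω (Real.exp (-ouZ (shift τ ω)) • u₀) g

end

end LatticeRDE

open LatticeRDE

namespace LatticeRDE

/-! The noise enters only through the continuous path `t ↦ z(θ_t ω)`, so for fixed `ω` the problem
is a deterministic equation in `ℓ²` whose coefficients are merely measurable in time and whose
nonlinearity is Lipschitz only on bounded sets. Clipping the argument of `f` at level `R` makes the
field globally Lipschitz on compact time intervals, and Picard iteration solves the clipped
equation.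

The point is that the a priori bound does not see `R`: the one-sided bound `∂ₓ f ≥ -β` yields `-β x²
≤ x f(x)`, and clipping preserves this with the same `β`. The energy estimate
(`norm_sq_le_gronwallBound`, `inner_truncField_le`) therefore bounds every clipped solution
independently of `R`, and for `R` large the clipping never acts. Conversely, a mild solution on a
compact interval is bounded, so it solves some clipped equation, inherits the a priori bound, and
thus solves the one at the common level. Uniqueness then follows from Grönwall.

The same level serves all nearby data, so `continuous_solution` gives continuity jointly in the
noise path (compact-open topology), the initial value and the forcing. Measurability in `ω` follows
because `ω ↦ z(θ_· ω)` is measurable into `C(ℝ, ℝ)`, whose Borel σ-algebra is generated by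
evaluations. The cocycle law is uniqueness after a restart combined with the group law of the
shifts.

On the probabilistic side, shift invariance is read off from increments starting to the left of all
times involved, and sublinear growth of almost every path is the strong law obtained from time
inversion. -/

/-! ### Carathéodory integral equations in a Banach space -/

section Integral

variable {E : Type*} [NormedAddCommGroup E]

/-- A time-dependent vector field on `[a, b]` that is Lipschitz in space with constant `L`,
bounded by `M` at the origin, and measurable along continuous curves. -/
structure IsLipschitzField (F : ℝ → E → E) (a b L M : ℝ) : Prop where
  nonneg : 0 ≤ L
  lip : ∀ t ∈ Icc a b, ∀ x y, ‖F t x - F t y‖ ≤ L * ‖x - y‖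
  bound : ∀ t ∈ Icc a b, ‖F t 0‖ ≤ M
  meas : ∀ x : ℝ → E, Continuous x →
    AEStronglyMeasurable (fun t => F t (x t)) (volume.restrict (Icc a b))

namespace IsLipschitzField

variable {F : ℝ → E → E} {a b L M : ℝ}

lemma norm_le (h : IsLipschitzField F a b L M) {t : ℝ} (ht : t ∈ Icc a b) (x : E) :
    ‖F t x‖ ≤ L * ‖x‖ + M := by
  have h1 := h.lip t ht x 0
  have h2 := h.bound t ht
  have h3 : ‖F t x‖ ≤ ‖F t x - F t 0‖ + ‖F t 0‖ := by
    simpa using norm_add_le (F t x - F t 0) (F t 0)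
  rw [sub_zero] at h1
  linarith

lemma integrableOn (h : IsLipschitzField F a b L M) {x : ℝ → E} (hx : ContinuousOn x (Icc a b)) :
    IntegrableOn (fun t => F t (x t)) (Icc a b) := by
  rcases le_or_gt a b with hab | hab
  · obtain ⟨C, hC⟩ := isCompact_Icc.exists_bound_of_continuousOn hx
    -- Measurability is assumed only along curves continuous on all of `ℝ`, so `x` is extended by
    -- its endpoint values.
    have hx' : Continuous (IccExtend hab ((Icc a b).domRestrict x)) :=
      (continuousOn_iff_continuous_domRestrict.1 hx).Icc_extend'
    have hm := (h.meas _ hx').congr (g := fun t => F t (x t)) <| by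
      filter_upwards [ae_restrict_mem measurableSet_Icc] with t ht
      rw [IccExtend_of_mem _ _ ht, domRestrict_apply]
    refine Integrable.of_bound hm (L * C + M) ?_
    filter_upwards [ae_restrict_mem measurableSet_Icc] with t ht
    exact (h.norm_le ht _).trans (by gcongr; exacts [h.nonneg, hC t ht])
  · simp [Icc_eq_empty hab.not_ge]

lemma intervalIntegrable (h : IsLipschitzField F a b L M) {x : ℝ → E}
    (hx : ContinuousOn x (Icc a b)) {s t : ℝ} (hs : s ∈ Icc a b) (ht : t ∈ Icc a b) :
    IntervalIntegrable (fun t => F t (x t)) volume s t :=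
  ((h.integrableOn hx).mono_set (uIcc_subset_Icc hs ht)).intervalIntegrable

end IsLipschitzField

variable [NormedSpace ℝ E]

/-- `x` solves `x(t) = x₀ + ∫ₐᵗ F(s, x(s)) ds` on `[a, b]`. -/
structure IsIntegralSolution (F : ℝ → E → E) (a b : ℝ) (x₀ : E) (x : ℝ → E) : Prop where
  cont : ContinuousOn x (Icc a b)
  eq : ∀ t ∈ Icc a b, x t = x₀ + ∫ s in a..t, F s (x s)

open Function Nat in
/-- The Picard–Lindelöf theorem for fields that are only measurable in time. -/
theorem IsLipschitzField.exists_isIntegralSolution [CompleteSpace E] {F : ℝ → E → E} {a b L M : ℝ}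
    (h : IsLipschitzField F a b L M) (hab : a ≤ b) (x₀ : E) :
    ∃ x, IsIntegralSolution F a b x₀ x := by
  have ha : a ∈ Icc a b := left_mem_Icc.2 hab
  let ext (x : C(Icc a b, E)) : ℝ → E := IccExtend hab x
  have hext (x : C(Icc a b, E)) : Continuous (ext x) := x.continuous.Icc_extend'
  have hint (x : C(Icc a b, E)) {s t : ℝ} (hs : s ∈ Icc a b) (ht : t ∈ Icc a b) :
      IntervalIntegrable (fun r => F r (ext x r)) volume s t :=
    h.intervalIntegrable (hext x).continuousOn hs ht
  have hprim (x : C(Icc a b, E)) :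
      ContinuousOn (fun t => x₀ + ∫ s in a..t, F s (ext x s)) (Icc a b) := by
    have := intervalIntegral.continuousOn_primitive_interval'
      (hint x ha (right_mem_Icc.2 hab)) left_mem_uIcc
    rw [uIcc_of_le hab] at this
    exact continuousOn_const.add this
  let Γ (x : C(Icc a b, E)) : C(Icc a b, E) :=
    ⟨_, continuousOn_iff_continuous_domRestrict.1 (hprim x)⟩
  have hΓ (x : C(Icc a b, E)) (t : Icc a b) : Γ x t = x₀ + ∫ s in a..t, F s (ext x s) := rfl
  -- `Γ` need not contract on a long interval. Keeping the dependence on `t` lets each integration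
  -- gain a factor `L (t - a) / (n + 1)`, so a high iterate contracts.
  have key (x y : C(Icc a b, E)) (n : ℕ) (t : Icc a b) :
      dist (Γ^[n] x t) (Γ^[n] y t) ≤ (L * (t - a)) ^ n / n ! * dist x y := by
    induction n generalizing t with
    | zero => simpa using ContinuousMap.dist_apply_le_dist t
    | succ n ih =>
      rw [iterate_succ_apply', iterate_succ_apply', dist_eq_norm, hΓ, hΓ, add_sub_add_left_eq_sub,
        ← intervalIntegral.integral_sub (hint _ ha t.2) (hint _ ha t.2)]
      have hb : ∀ s ∈ Ioc a (t : ℝ), ‖F s (ext (Γ^[n] x) s) - F s (ext (Γ^[n] y) s)‖ ≤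
          L ^ (n + 1) / n ! * dist x y * (s - a) ^ n := by
        intro s hs
        have hs' : s ∈ Icc a b := ⟨hs.1.le, hs.2.trans t.2.2⟩
        refine (h.lip s hs' _ _).trans ?_
        have := ih ⟨s, hs'⟩
        rw [dist_eq_norm] at this
        simp only [ext, IccExtend_of_mem _ _ hs']
        refine (mul_le_mul_of_nonneg_left this h.nonneg).trans (le_of_eq ?_)
        rw [mul_pow, pow_succ]
        ring
      refine (intervalIntegral.norm_integral_le_of_norm_le t.2.1
        (ae_of_all _ hb) ((by fun_prop : Continuous _).intervalIntegrable _ _)).trans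
        (le_of_eq ?_)
      rw [intervalIntegral.integral_const_mul,
        intervalIntegral.integral_comp_sub_right (fun s => s ^ n) a, integral_pow, sub_self,
        zero_pow (Nat.succ_ne_zero n), sub_zero, Nat.factorial_succ, mul_pow]
      push_cast
      field_simp
  obtain ⟨n, hn⟩ := ((FloorSemiring.tendsto_pow_div_factorial_atTop (L * (b - a))).eventually
    (gt_mem_nhds zero_lt_one)).exists
  have hL := h.nonneg
  have hba : 0 ≤ b - a := sub_nonneg.2 hab
  have hLn : 0 ≤ (L * (b - a)) ^ n / n ! :=
    div_nonneg (pow_nonneg (mul_nonneg hL hba) n) (Nat.cast_nonneg _)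
  have hC : ContractingWith (NNReal.mk _ hLn) Γ^[n] := by
    refine ⟨hn, LipschitzWith.of_dist_le_mul fun x y => ?_⟩
    rw [NNReal.coe_mk, ContinuousMap.dist_le (mul_nonneg hLn dist_nonneg)]
    intro t
    refine (key x y n t).trans ?_
    have h0 : 0 ≤ (t : ℝ) - a := sub_nonneg.2 t.2.1
    have h1 : (t : ℝ) - a ≤ b - a := sub_le_sub_right t.2.2 a
    change _ ≤ (L * (b - a)) ^ n / n ! * dist x y
    gcongr
  have hfix : IsFixedPt Γ _ := hC.isFixedPt_fixedPoint_iterate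
  set x := ContractingWith.fixedPoint Γ^[n] hC
  refine ⟨ext x, (hext x).continuousOn, fun t ht => ?_⟩
  have := congrArg (fun y : C(Icc a b, E) => y ⟨t, ht⟩) hfix
  simp only [hΓ] at this
  rw [this]
  simp only [ext, IccExtend_of_mem _ _ ht]

/-- Grönwall's inequality in integral form. -/
theorem le_mul_exp_of_le_add_integral {u : ℝ → ℝ} {a b δ K : ℝ} (hK : 0 ≤ K)
    (hu : ContinuousOn u (Icc a b)) (h : ∀ t ∈ Icc a b, u t ≤ δ + K * ∫ s in a..t, u s) :
    ∀ t ∈ Icc a b, u t ≤ δ * Real.exp (K * (t - a)) := by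
  intro t ht
  have hab : a ≤ b := ht.1.trans ht.2
  set w := IccExtend hab ((Icc a b).domRestrict u)
  have hw : Continuous w := (continuousOn_iff_continuous_domRestrict.1 hu).Icc_extend'
  have hwu : ∀ s ∈ Icc a b, w s = u s := fun s hs => by simp [w, IccExtend_of_mem _ _ hs, domRestrict_apply]
  have hI : ∀ s ∈ Icc a b, ∫ r in a..s, w r = ∫ r in a..s, u r := fun s hs =>
    intervalIntegral.integral_congr fun r hr => by
      rw [uIcc_of_le hs.1] at hr
      exact hwu r ⟨hr.1, hr.2.trans hs.2⟩
  -- `u` itself need not be differentiable; the differential Grönwall inequality is applied to the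
  -- right-hand side of the hypothesis, which dominates `u`.
  have hd (s : ℝ) : HasDerivAt (fun t => δ + K * ∫ r in a..t, w r) (K * w s) s :=
    ((intervalIntegral.integral_hasDerivAt_right (hw.intervalIntegrable _ _)
      (hw.stronglyMeasurableAtFilter _ _) hw.continuousAt).const_mul K).const_add δ
  have := le_gronwallBound_of_liminf_deriv_right_le (K := K) (ε := 0) (δ := δ)
    (fun s _ => (hd s).continuousAt.continuousWithinAt)
    (fun s _ r hr => (hd s).hasDerivWithinAt.liminf_right_slope_le hr) (by simp)
    (fun s hs => by
      have hs' := Ico_subset_Icc_self hs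
      have := h s hs'
      rw [add_zero]
      gcongr
      rw [hwu s hs', hI s hs']
      exact this) t ht
  rw [gronwallBound_ε0] at this
  refine (h t ht).trans ?_
  rwa [hI t ht] at this

/-- Solutions of two integral equations differ by at most the difference of the initial values and
the integrated difference of the fields along one of them. -/
theorem norm_sub_le_of_isIntegralSolution {F G : ℝ → E → E} {a b L M N L' : ℝ} {x₀ y₀ : E}
    {x y : ℝ → E} (hF : IsLipschitzField F a b L M) (hG : IsLipschitzField G a b L' N)
    (hx : IsIntegralSolution F a b x₀ x) (hy : IsIntegralSolution G a b y₀ y) :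
    ∀ t ∈ Icc a b, ‖x t - y t‖ ≤
      (‖x₀ - y₀‖ + ∫ s in a..b, ‖F s (y s) - G s (y s)‖) * Real.exp (L * (t - a)) := by
  refine le_mul_exp_of_le_add_integral hF.nonneg (hx.cont.sub hy.cont).norm fun t ht => ?_
  have hab : a ≤ b := ht.1.trans ht.2
  have ha : a ∈ Icc a b := left_mem_Icc.2 hab
  have hb : b ∈ Icc a b := right_mem_Icc.2 hab
  have i1 {s r} (hs : s ∈ Icc a b) (hr : r ∈ Icc a b) := hF.intervalIntegrable hx.cont hs hr
  have i2 {s r} (hs : s ∈ Icc a b) (hr : r ∈ Icc a b) := hF.intervalIntegrable hy.cont hs hr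
  have i3 {s r} (hs : s ∈ Icc a b) (hr : r ∈ Icc a b) := hG.intervalIntegrable hy.cont hs hr
  -- Inserting `F s (y s)` uses the Lipschitz constant of `F` alone and compares the two fields only
  -- along the fixed curve `y`.
  have e : x t - y t = (x₀ - y₀) + (∫ s in a..t, (F s (x s) - F s (y s)))
      + ∫ s in a..t, (F s (y s) - G s (y s)) := by
    rw [hx.eq t ht, hy.eq t ht, intervalIntegral.integral_sub (i1 ha ht) (i2 ha ht),
      intervalIntegral.integral_sub (i2 ha ht) (i3 ha ht)]
    abel
  have b1 : ‖∫ s in a..t, (F s (x s) - F s (y s))‖ ≤ L * ∫ s in a..t, ‖x s - y s‖ := by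
    rw [← intervalIntegral.integral_const_mul]
    refine intervalIntegral.norm_integral_le_of_norm_le ht.1
      (ae_of_all _ fun s hs => hF.lip s ⟨hs.1.le, hs.2.trans ht.2⟩ _ _) ?_
    refine ContinuousOn.intervalIntegrable (continuousOn_const.mul ?_)
    rw [uIcc_of_le ht.1]
    exact (hx.cont.sub hy.cont).norm.mono (Icc_subset_Icc_right ht.2)
  have b2 : ‖∫ s in a..t, (F s (y s) - G s (y s))‖ ≤ ∫ s in a..b, ‖F s (y s) - G s (y s)‖ :=
    (intervalIntegral.norm_integral_le_integral_norm ht.1).trans <|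
      intervalIntegral.integral_mono_interval le_rfl ht.1 ht.2
        (ae_of_all _ fun _ => norm_nonneg _) ((i2 ha hb).sub (i3 ha hb)).norm
  rw [e]
  refine (norm_add₃_le).trans ?_
  linarith

end Integral

/-! ### Energy estimate in a Hilbert space -/

section Energy

variable {H : Type*} [NormedAddCommGroup H] [InnerProductSpace ℝ H] [CompleteSpace H]

open scoped RealInnerProductSpace

/-- If `x(t) = x₀ + ∫ₐᵗ y` with `y` bounded and `⟪x, y⟫ ≤ K ‖x‖² + C`, then `‖x‖²` obeys the
corresponding Grönwall bound. -/
theorem norm_sq_le_gronwallBound {x y : ℝ → H} {x₀ : H} {a b K C M δ : ℝ}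
    (hδ : ‖x₀‖ ^ 2 ≤ δ)
    (hx : ContinuousOn x (Icc a b)) (hy : IntegrableOn y (Icc a b))
    (hM : ∀ t ∈ Icc a b, ‖y t‖ ≤ M) (hxy : ∀ t ∈ Icc a b, x t = x₀ + ∫ s in a..t, y s)
    (hK : ∀ t ∈ Icc a b, ⟪x t, y t⟫ ≤ K * ‖x t‖ ^ 2 + C) :
    ∀ t ∈ Icc a b, ‖x t‖ ^ 2 ≤ gronwallBound δ (2 * K) (2 * C) (t - a) := by
  intro t₁ ht₁
  have hab : a ≤ b := ht₁.1.trans ht₁.2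
  have hM0 : 0 ≤ M := (norm_nonneg _).trans (hM _ ht₁)
  have hxa : x a = x₀ := by simpa using hxy a (left_mem_Icc.2 hab)
  have hint {s t : ℝ} (hs : s ∈ Icc a b) (ht : t ∈ Icc a b) : IntervalIntegrable y volume s t :=
    (hy.mono_set (uIcc_subset_Icc hs ht)).intervalIntegrable
  -- With `y` only integrable, `x` need not be differentiable at a given time; a bound on the lower
  -- right derivative of `‖x‖²` suffices.
  refine le_gronwallBound_of_liminf_deriv_right_le (f := fun t => ‖x t‖ ^ 2)
    (f' := fun t => 2 * K * ‖x t‖ ^ 2 + 2 * C) (hx.norm.pow 2) ?_ (by simpa [hxa] using hδ)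
    (fun _ _ => le_rfl) t₁ ht₁
  intro t ht r hr
  have ht' : t ∈ Icc a b := Ico_subset_Icc_self ht
  -- One `ε` pays for the variation of `K * ‖x‖ ^ 2` near `t`, and `ε * M` for replacing `x z` by `x
  -- s` in the inner product with `y s`. The choice uses up half of the gap below `r`.
  obtain ⟨ε, hε, hεr⟩ : ∃ ε > 0, 2 * (K * ‖x t‖ ^ 2 + C + ε + ε * M) < r := by
    refine ⟨(r - (2 * K * ‖x t‖ ^ 2 + 2 * C)) / (4 * (1 + M)), by
      have := sub_pos.2 hr; positivity, ?_⟩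
    have : (r - (2 * K * ‖x t‖ ^ 2 + 2 * C)) / (4 * (1 + M)) * (1 + M) =
      (r - (2 * K * ‖x t‖ ^ 2 + 2 * C)) / 4 := by field_simp
    linarith [sub_pos.2 hr]
  have hc : ContinuousWithinAt x (Icc a b) t := hx t ht'
  have h1 : ∀ᶠ s in 𝓝[Icc a b] t, K * ‖x s‖ ^ 2 < K * ‖x t‖ ^ 2 + ε :=
    ((hc.norm.pow 2).const_mul K).eventually_lt_const (by simpa using hε)
  have h2 : ∀ᶠ s in 𝓝[Icc a b] t, ‖x s - x t‖ < ε / 2 :=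
    (hc.sub_const (x t)).norm.eventually_lt_const (by simpa using hε)
  obtain ⟨η, hη, hη'⟩ := Metric.mem_nhdsWithin_iff.1 (h1.and h2)
  have hev : ∀ᶠ z in 𝓝[>] t, z ∈ Ioo t (min b (t + η)) :=
    Ioo_mem_nhdsGT (lt_min ht.2 (by linarith))
  refine (hev.mono fun z hz => ?_).frequently
  have hzb : z < b := hz.2.trans_le (min_le_left _ _)
  have hzη : z < t + η := hz.2.trans_le (min_le_right _ _)
  have hz' : z ∈ Icc a b := ⟨ht.1.trans hz.1.le, hzb.le⟩
  have hs : ∀ s ∈ Icc t z, s ∈ Icc a b ∧ K * ‖x s‖ ^ 2 < K * ‖x t‖ ^ 2 + ε ∧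
      ‖x s - x t‖ < ε / 2 := fun s hs => by
    have hsab : s ∈ Icc a b := ⟨ht.1.trans hs.1, hs.2.trans hzb.le⟩
    refine ⟨hsab, hη' ⟨?_, hsab⟩⟩
    rw [Metric.mem_ball, Real.dist_eq, abs_lt]
    constructor <;> linarith [hs.1, hs.2]
  have hdiff : x z - x t = ∫ s in t..z, y s := by
    rw [hxy z hz', hxy t ht', add_sub_add_left_eq_sub,
      intervalIntegral.integral_interval_sub_left (hint (left_mem_Icc.2 hab) hz')
        (hint (left_mem_Icc.2 hab) ht')]
  have hinner : ⟪x z, x z - x t⟫ ≤ (z - t) * (K * ‖x t‖ ^ 2 + C + ε + ε * M) := by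
    have hcomm : ⟪x z, ∫ s in t..z, y s⟫ = ∫ s in t..z, ⟪x z, y s⟫ :=
      ((innerSL ℝ (x z)).intervalIntegral_comp_comm (hint ht' hz')).symm
    have hi : IntervalIntegrable (fun s => ⟪x z, y s⟫) volume t z := by
      have h := hint ht' hz'
      exact ⟨(innerSL ℝ (x z)).integrable_comp h.1, (innerSL ℝ (x z)).integrable_comp h.2⟩
    rw [hdiff, hcomm]
    have := intervalIntegral.integral_mono_on hz.1.le hi
      (intervalIntegrable_const (c := K * ‖x t‖ ^ 2 + C + ε + ε * M)) fun s hs' => ?_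
    · rwa [intervalIntegral.integral_const, smul_eq_mul] at this
    obtain ⟨hsab, hs1, hs2⟩ := hs s hs'
    have hs3 := (hs z ⟨hz.1.le, le_rfl⟩).2.2
    have e1 : ‖x z - x s‖ ≤ ε := by
      have : x z - x s = (x z - x t) - (x s - x t) := by abel
      rw [this]
      exact (norm_sub_le _ _).trans (by linarith)
    have e2 : ⟪x z, y s⟫ = ⟪x s, y s⟫ + ⟪x z - x s, y s⟫ := by
      rw [← inner_add_left]; congr 1; abel
    have e3 : ⟪x z - x s, y s⟫ ≤ ε * M :=
      (real_inner_le_norm _ _).trans (by gcongr; exact hM s hsab)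
    linarith [hK s hsab]
  have hsq : ‖x z‖ ^ 2 - ‖x t‖ ^ 2 ≤ 2 * ⟪x z, x z - x t⟫ := by
    have h := sq_nonneg ‖x z - x t‖
    rw [norm_sub_sq_real] at h
    rw [inner_sub_right, real_inner_self_eq_norm_sq]
    linarith
  have hzt : 0 < z - t := sub_pos.2 hz.1
  rw [inv_mul_lt_iff₀ hzt]
  calc ‖x z‖ ^ 2 - ‖x t‖ ^ 2 ≤ (z - t) * (2 * (K * ‖x t‖ ^ 2 + C + ε + ε * M)) := by linarith
    _ < (z - t) * r := by gcongr

end Energy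

/-! ### Operators on `ℓ²` -/

open Classical in
/-- The element of `ℓ²` with given coordinates (zero if they are not square summable). -/
noncomputable def ofSeq (w : ℤ → ℝ) : EllTwo := if h : Memℓp w 2 then ⟨w, h⟩ else 0

lemma ofSeq_apply {w : ℤ → ℝ} (h : Memℓp w 2) (i : ℤ) : ofSeq w i = w i := by
  rw [ofSeq, dif_pos h]

lemma norm_le_mul_of_abs_le {v w : EllTwo} {L : ℝ} (hL : 0 ≤ L) (h : ∀ i, |v i| ≤ L * |w i|) :
    ‖v‖ ≤ L * ‖w‖ := by
  have := lp.norm_mono (p := 2) (by norm_num) (x := v) (y := L • w) fun i => by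
    simpa [abs_mul, abs_of_nonneg hL] using h i
  rwa [norm_smul, Real.norm_of_nonneg hL] at this

/-- The superposition operator `v ↦ (φᵢ(vᵢ))ᵢ` on `ℓ²`. -/
noncomputable def nemytskii (φ : ℤ → ℝ → ℝ) (v : EllTwo) : EllTwo := ofSeq fun i => φ i (v i)

/-- The functions `φᵢ` vanish at the origin and are Lipschitz with a common constant. -/
structure IsLipschitzFamily (φ : ℤ → ℝ → ℝ) (L : ℝ) : Prop where
  nonneg : 0 ≤ L
  zero : ∀ i, φ i 0 = 0
  lip : ∀ i x y, |φ i x - φ i y| ≤ L * |x - y|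

namespace IsLipschitzFamily

variable {φ : ℤ → ℝ → ℝ} {L : ℝ}

lemma mulLeft {c : ℤ → ℝ} (hL : 0 ≤ L) (hc : ∀ i, |c i| ≤ L) :
    IsLipschitzFamily (fun i x => c i * x) L where
  nonneg := hL
  zero := by simp
  lip i x y := by
    rw [← mul_sub, abs_mul]
    gcongr
    exact hc i

lemma memlp (h : IsLipschitzFamily φ L) (v : EllTwo) : Memℓp (fun i => φ i (v i)) 2 := by
  refine Memℓp.mono (g := fun i => ‖L * v i‖) ?_ fun i => ?_
  · exact (memℓp_norm_iff (E := fun _ : ℤ => ℝ)).2 ((lp.memℓp v).const_mul L)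
  · have := h.lip i (v i) 0
    rw [h.zero i, sub_zero, sub_zero] at this
    rwa [Real.norm_eq_abs, Real.norm_eq_abs, abs_mul, abs_of_nonneg h.nonneg]

lemma nemytskii_apply (h : IsLipschitzFamily φ L) (v : EllTwo) (i : ℤ) :
    nemytskii φ v i = φ i (v i) :=
  ofSeq_apply (h.memlp v) i

lemma norm_nemytskii_sub_le (h : IsLipschitzFamily φ L) (v w : EllTwo) :
    ‖nemytskii φ v - nemytskii φ w‖ ≤ L * ‖v - w‖ :=
  norm_le_mul_of_abs_le h.nonneg fun i => by
    simpa [h.nemytskii_apply] using h.lip i (v i) (w i)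

lemma nemytskii_zero (h : IsLipschitzFamily φ L) : nemytskii φ 0 = 0 := by
  ext i
  simp [h.nemytskii_apply, h.zero]

lemma norm_nemytskii_le (h : IsLipschitzFamily φ L) (v : EllTwo) :
    ‖nemytskii φ v‖ ≤ L * ‖v‖ := by
  simpa [h.nemytskii_zero] using h.norm_nemytskii_sub_le v 0

lemma continuous_nemytskii (h : IsLipschitzFamily φ L) : Continuous (nemytskii φ) :=
  (LipschitzWith.of_dist_le_mul (K := NNReal.mk L h.nonneg) fun v w => by
    simpa [dist_eq_norm] using h.norm_nemytskii_sub_le v w).continuous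

-- The inner product is the sum of the `vᵢ φᵢ(vᵢ)`, so the scalar bound can be summed. The constant
-- `L` serves only to keep the image in `ℓ²`.
open scoped RealInnerProductSpace in
lemma neg_mul_le_inner_nemytskii (h : IsLipschitzFamily φ L) {β : ℝ}
    (hβ : ∀ i x, -β * x ^ 2 ≤ x * φ i x) (v : EllTwo) :
    -β * ‖v‖ ^ 2 ≤ ⟪v, nemytskii φ v⟫ := by
  have h1 := (lp.hasSum_inner (𝕜 := ℝ) v v).mul_left (-β)
  rw [real_inner_self_eq_norm_sq] at h1
  refine hasSum_le (fun i => ?_) h1 (lp.hasSum_inner v (nemytskii φ v))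
  have := hβ i (v i)
  rw [h.nemytskii_apply]
  simp only [RCLike.inner_apply, conj_trivial]
  linarith [mul_comm (v i) (φ i (v i)), sq (v i)]

end IsLipschitzFamily

/-- The translate `(v_{i+k})ᵢ` of an element of `ℓ²`. -/
def translate (k : ℤ) (v : EllTwo) : EllTwo :=
  ⟨fun i => v (i + k), (memℓp_gen_iff (by norm_num)).2 <|
    (Equiv.addRight k).summable_iff.2 ((lp.memℓp v).summable (by norm_num))⟩

@[simp] lemma translate_apply (k : ℤ) (v : EllTwo) (i : ℤ) : translate k v i = v (i + k) := rfl

lemma norm_translate (k : ℤ) (v : EllTwo) : ‖translate k v‖ = ‖v‖ := by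
  rw [lp.norm_eq_tsum_rpow (by norm_num), lp.norm_eq_tsum_rpow (by norm_num)]
  congr 1
  exact (Equiv.addRight k).tsum_eq fun i => ‖v i‖ ^ (2 : ENNReal).toReal

/-- The discrete Laplacian `(-v_{i-1} + 2 v_i - v_{i+1})ᵢ`. -/
noncomputable def laplacian (v : EllTwo) : EllTwo := (2 : ℝ) • v - translate 1 v - translate (-1) v

lemma laplacian_apply (v : EllTwo) (i : ℤ) :
    laplacian v i = -v (i - 1) + 2 * v i - v (i + 1) := by
  simp only [laplacian, lp.coeFn_sub, lp.coeFn_smul, Pi.sub_apply, Pi.smul_apply, smul_eq_mul,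
    translate_apply, ← sub_eq_add_neg]
  ring

lemma laplacian_sub (v w : EllTwo) : laplacian (v - w) = laplacian v - laplacian w := by
  ext i
  simp only [laplacian_apply, lp.coeFn_sub, Pi.sub_apply]
  ring

lemma norm_laplacian_le (v : EllTwo) : ‖laplacian v‖ ≤ 4 * ‖v‖ := by
  have h1 := norm_sub_le ((2 : ℝ) • v - translate 1 v) (translate (-1) v)
  have h2 := norm_sub_le ((2 : ℝ) • v) (translate 1 v)
  rw [norm_smul, norm_translate] at h2
  rw [norm_translate] at h1
  norm_num at h2
  rw [laplacian]
  linarith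

lemma continuous_laplacian : Continuous laplacian :=
  (LipschitzWith.of_dist_le_mul (K := 4) fun v w => by
    simpa [dist_eq_norm, laplacian_sub] using norm_laplacian_le (v - w)).continuous

/-! ### Measurability in `ℓ²` -/

lemma continuous_coord (i : ℤ) : Continuous fun v : EllTwo => v i :=
  (lp.lipschitzWith_one_eval 2 i).continuous

/-- Finite sections depend continuously on finitely many coordinates and converge in `ℓ²` to the
full sequence. -/
lemma aestronglyMeasurable_of_coord {α : Type*} {m : MeasurableSpace α} {μ : Measure α}
    {h : α → EllTwo} (hh : ∀ i, AEStronglyMeasurable (fun a => h a i) μ) :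
    AEStronglyMeasurable h μ := by
  refine aestronglyMeasurable_of_tendsto_ae (u := (atTop : Filter (Finset ℤ)))
    (f := fun s a => ∑ i ∈ s, lp.single 2 i (h a i)) (fun s => ?_)
    (ae_of_all _ fun a => lp.hasSum_single (by norm_num) (h a))
  exact Finset.aestronglyMeasurable_fun_sum _ fun i _ =>
    (lp.isometry_single i).continuous.comp_aestronglyMeasurable (hh i)

/-- The unit sequences have dense span. Second countability makes the Borel σ-algebra of a product
with `ℓ²` the product σ-algebra. -/
instance : SecondCountableTopology EllTwo := by
  have : TopologicalSpace.SeparableSpace EllTwo := by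
    have hs : TopologicalSpace.IsSeparable (range fun i : ℤ => (lp.single 2 i (1 : ℝ) : EllTwo)) :=
      (countable_range _).isSeparable
    rw [← TopologicalSpace.isSeparable_univ_iff]
    refine (hs.span (R := ℝ)).closure.mono fun v _ => ?_
    refine mem_closure_of_tendsto (lp.hasSum_single (by norm_num) v) (Eventually.of_forall ?_)
    intro s
    refine Submodule.sum_mem _ fun i _ => ?_
    have : (lp.single 2 i (v i) : EllTwo) = v i • lp.single 2 i (1 : ℝ) := by
      rw [← lp.single_smul]; simp
    rw [this]
    exact Submodule.smul_mem _ _ (Submodule.subset_span (mem_range_self i))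
  exact UniformSpace.secondCountable_of_separable _

/-- The coordinate functionals on `ℓ²`. -/
noncomputable def coordCLM (i : ℤ) : EllTwo →L[ℝ] ℝ :=
  LinearMap.mkContinuous
    { toFun := fun v => v i, map_add' := fun _ _ => rfl, map_smul' := fun _ _ => rfl } 1
    fun v => by rw [one_mul]; exact lp.norm_apply_le_norm (by norm_num) v i

lemma intervalIntegrable_coord {h : ℝ → EllTwo} {a b : ℝ}
    (hh : IntervalIntegrable h volume a b) (i : ℤ) :
    IntervalIntegrable (fun s => h s i) volume a b :=
  ⟨(coordCLM i).integrable_comp hh.1, (coordCLM i).integrable_comp hh.2⟩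

lemma intervalIntegral_coord {h : ℝ → EllTwo} {a b : ℝ} (hh : IntervalIntegrable h volume a b)
    (i : ℤ) : (∫ s in a..b, h s) i = ∫ s in a..b, h s i :=
  ((coordCLM i).intervalIntegral_comp_comm hh).symm

/-! ### Truncation of the nonlinearity -/

/-- The projection of `ℝ` onto `[-R, R]`. -/
def clip (R x : ℝ) : ℝ := max (-R) (min x R)

lemma clip_mem {R : ℝ} (hR : 0 ≤ R) (x : ℝ) : clip R x ∈ Icc (-R) R :=
  ⟨le_max_left _ _, max_le (by linarith) (min_le_right _ _)⟩

lemma clip_eq_self {R x : ℝ} (h : |x| ≤ R) : clip R x = x := by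
  rw [abs_le] at h
  rw [clip, min_eq_left h.2, max_eq_right h.1]

lemma clip_zero {R : ℝ} (hR : 0 ≤ R) : clip R 0 = 0 := clip_eq_self (by simpa using hR)

lemma abs_clip_sub_le (R x y : ℝ) : |clip R x - clip R y| ≤ |x - y| := by
  have h1 := abs_max_sub_max_le_max (-R) (min x R) (-R) (min y R)
  have h2 := abs_min_sub_min_le_max x R y R
  rw [sub_self, abs_zero, max_eq_right (abs_nonneg (min x R - min y R))] at h1
  rw [sub_self, abs_zero, max_eq_left (abs_nonneg (x - y))] at h2
  exact h1.trans h2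

lemma continuous_clip (R : ℝ) : Continuous (clip R) := by
  unfold clip
  fun_prop

/-- Lower bounds `-β x² ≤ x φ(x)` survive truncation. -/
lemma neg_mul_sq_le_mul_clip {φ : ℝ → ℝ} {β R : ℝ} (hβ : 0 ≤ β) (hR : 0 ≤ R)
    (h : ∀ x, -β * x ^ 2 ≤ x * φ x) (h0 : φ 0 = 0) (x : ℝ) :
    -β * x ^ 2 ≤ x * φ (clip R x) := by
  rcases lt_trichotomy x 0 with hx | rfl | hx
  -- For `x < 0` and `R > 0`, `x ≤ clip R x < 0`. Dividing the bound at `clip R x` by this negative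
  -- number gives `φ (clip R x) ≤ -β * clip R x ≤ -β * x`, to be multiplied by `x`. For `R = 0` one
  -- cannot divide, but then `φ` is evaluated at `0`.
  · have hc : x ≤ clip R x := by
      rw [clip, min_eq_left (hx.le.trans hR)]
      exact le_max_right _ _
    rcases hR.eq_or_lt with rfl | hR
    · have : clip 0 x = 0 := by
        have := clip_mem le_rfl x
        simp only [neg_zero, Icc_self, mem_singleton_iff] at this
        exact this
      rw [this, h0]
      nlinarith [sq_nonneg x]
    · have hn : clip R x < 0 := max_lt (by linarith) ((min_le_left _ _).trans_lt hx)
      have h1 : φ (clip R x) ≤ -β * clip R x := by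
        have := h (clip R x)
        nlinarith
      nlinarith [mul_nonneg hβ (sub_nonneg.2 hc)]
  · simp
  · have hc : clip R x ≤ x := max_le (by linarith) (min_le_left _ _)
    rcases hR.eq_or_lt with rfl | hR
    · have : clip 0 x = 0 := by
        have := clip_mem le_rfl x
        simp only [neg_zero, Icc_self, mem_singleton_iff] at this
        exact this
      rw [this, h0]
      nlinarith [sq_nonneg x]
    · have hn : 0 < clip R x := lt_max_of_lt_right (lt_min hx hR)
      have h1 : -β * clip R x ≤ φ (clip R x) := by
        have := h (clip R x)
        nlinarith
      nlinarith [mul_nonneg hβ (sub_nonneg.2 hc)]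

/-- The function `φ y + β y` is nondecreasing and vanishes at `0`, so its sign agrees with that of
`y`. -/
lemma neg_mul_sq_le_mul_of_deriv_ge {φ : ℝ → ℝ} {β : ℝ} (hd : Differentiable ℝ φ) (h0 : φ 0 = 0)
    (hβ : ∀ x, -β ≤ deriv φ x) (x : ℝ) : -β * x ^ 2 ≤ x * φ x := by
  have hmono : Monotone fun y => φ y + β * y := by
    refine monotone_of_deriv_nonneg (by fun_prop) fun y => ?_
    have : HasDerivAt (fun y => φ y + β * y) (deriv φ y + β * 1) y :=
      (hd y).hasDerivAt.add ((hasDerivAt_id y).const_mul β)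
    rw [this.deriv]
    linarith [hβ y]
  rcases le_total 0 x with hx | hx
  · have := hmono hx
    simp only [h0, mul_zero, add_zero] at this
    nlinarith
  · have := hmono hx
    simp only [h0, mul_zero, add_zero] at this
    nlinarith

/-- The consequences of the assumptions that the solution theory uses: measurable bounded linear
coefficients, and a continuous nonlinearity whose truncations are Lipschitz on bounded time
intervals and satisfy `x f(x) ≥ -β x²`. -/
structure IsAdmissible (ν lam : ℤ → ℝ → ℝ) (f : ℤ → ℝ → ℝ → ℝ) (c β : ℝ) : Prop where
  c_nonneg : 0 ≤ c
  β_nonneg : 0 ≤ β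
  ν_meas : ∀ i, AEStronglyMeasurable (ν i) volume
  lam_meas : ∀ i, AEStronglyMeasurable (lam i) volume
  ν_le : ∀ i t, |ν i t| ≤ c
  lam_le : ∀ i t, |lam i t| ≤ c
  f_cont : ∀ i, Continuous fun p : ℝ × ℝ => f i p.1 p.2
  f_lip : ∀ R, 0 ≤ R → ∀ a b, ∃ L, ∀ t ∈ Icc a b,
    IsLipschitzFamily (fun i x => f i (clip R x) t) L
  f_diss : ∀ R, 0 ≤ R → ∀ i x t, -β * x ^ 2 ≤ x * f i (clip R x) t

/-- The common Lipschitz constant is the maximum of `ζ R` over a compact time interval, transferred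
by the mean value inequality on `[-R, R]` and the fact that clipping is nonexpansive. -/
lemma exists_isAdmissible {ν lam : ℤ → ℝ → ℝ} {f : ℤ → ℝ → ℝ → ℝ} (hA1 : AssumptionA1 ν lam)
    (hA2 : AssumptionA2 f) (hA3 : AssumptionA3 f) : ∃ c β, IsAdmissible ν lam f c β := by
  obtain ⟨hν, hlam, ⟨l₀, l₁, hl₀, hl₁, hl⟩, ⟨n₀, n₁, hn₀, hn₁, hn⟩⟩ := hA1
  obtain ⟨hc, hd, h0, -, ⟨β, hβ0, hβ⟩⟩ := hA2
  obtain ⟨ζ, hζc, hζ0, hζ⟩ := hA3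
  refine ⟨max n₁ l₁, β, le_max_of_le_left hn₁.le, hβ0, fun i => (hν i).aestronglyMeasurable,
    fun i => (hlam i).aestronglyMeasurable, fun i t => ?_, fun i t => ?_, hc,
    fun R hR a b => ?_, fun R hR i x t => neg_mul_sq_le_mul_clip hβ0 hR
      (neg_mul_sq_le_mul_of_deriv_ge (hd i t) (h0 i t) (hβ i · t)) (h0 i t) x⟩
  · rw [abs_of_nonneg (hn₀.le.trans (hn i t).1)]
    exact le_max_of_le_left (hn i t).2
  · rw [abs_of_nonneg (hl₀.le.trans (hl i t).1)]
    exact le_max_of_le_right (hl i t).2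
  · have hζR : ContinuousOn (ζ R) (Icc a b) :=
      hζc.comp (f := fun t => (R, t)) (by fun_prop) fun t _ => ⟨hR, mem_univ t⟩
    obtain ⟨L, hL⟩ := isCompact_Icc.exists_bound_of_continuousOn hζR
    refine ⟨L, fun t ht => ⟨(norm_nonneg _).trans (hL t ht), fun i => ?_, fun i x y => ?_⟩⟩
    · rw [clip_zero hR, h0]
    · have hlip := (convex_Icc (-R) R).norm_image_sub_le_of_norm_deriv_le
        (f := fun x => f i x t) (fun x _ => hd i t x)
        (fun x hx => (hζ R hR t i x hx).trans ((le_abs_self _).trans (hL t ht)))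
        (clip_mem hR y) (clip_mem hR x)
      exact hlip.trans
        (mul_le_mul_of_nonneg_left (abs_clip_sub_le R x y) ((norm_nonneg _).trans (hL t ht)))

/-! ### The truncated lattice field -/

/-- The right-hand side of the lattice equation as a vector of `ℓ²`, with the nonlinearity
truncated at `R`, the noise value `z` and the forcing value `γ`. -/
noncomputable def truncField (ν lam : ℤ → ℝ → ℝ) (f : ℤ → ℝ → ℝ → ℝ) (R t z : ℝ) (γ v : EllTwo) :
    EllTwo :=
  -nemytskii (fun i x => ν i t * x) (laplacian v) - nemytskii (fun i x => lam i t * x) v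
    - Real.exp (-z) • nemytskii (fun i x => f i (clip R x) t) (Real.exp z • v)
    + Real.exp (-z) • γ + z • v

/-- The coordinates of the right-hand side of the lattice equation with noise value `z` and
forcing value `γ`. -/
noncomputable def coordField (ν lam : ℤ → ℝ → ℝ) (f : ℤ → ℝ → ℝ → ℝ) (t z : ℝ) (γ v : EllTwo)
    (i : ℤ) : ℝ :=
  -ν i t * (-v (i - 1) + 2 * v i - v (i + 1)) - lam i t * v i
    - Real.exp (-z) * f i (Real.exp z * v i) t + Real.exp (-z) * γ i + z * v i

namespace IsAdmissible

variable {ν lam : ℤ → ℝ → ℝ} {f : ℤ → ℝ → ℝ → ℝ} {c β : ℝ}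

lemma ν_family (h : IsAdmissible ν lam f c β) (t : ℝ) :
    IsLipschitzFamily (fun i x => ν i t * x) c :=
  IsLipschitzFamily.mulLeft h.c_nonneg (h.ν_le · t)

lemma lam_family (h : IsAdmissible ν lam f c β) (t : ℝ) :
    IsLipschitzFamily (fun i x => lam i t * x) c :=
  IsLipschitzFamily.mulLeft h.c_nonneg (h.lam_le · t)

lemma truncField_apply (h : IsAdmissible ν lam f c β) {R t L : ℝ}
    (hL : IsLipschitzFamily (fun i x => f i (clip R x) t) L) (z : ℝ) (γ v : EllTwo) (i : ℤ) :
    truncField ν lam f R t z γ v i =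
      coordField ν lam (fun i x t => f i (clip R x) t) t z γ v i := by
  simp only [truncField, coordField, lp.coeFn_add, lp.coeFn_sub, lp.coeFn_neg, lp.coeFn_smul,
    Pi.add_apply, Pi.sub_apply, Pi.neg_apply, Pi.smul_apply, smul_eq_mul,
    (h.ν_family t).nemytskii_apply, (h.lam_family t).nemytskii_apply, hL.nemytskii_apply,
    laplacian_apply]
  ring

lemma continuous_truncField (h : IsAdmissible ν lam f c β) {R t L : ℝ}
    (hL : IsLipschitzFamily (fun i x => f i (clip R x) t) L) :
    Continuous fun p : ℝ × EllTwo × EllTwo => truncField ν lam f R t p.1 p.2.1 p.2.2 := by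
  have h1 := (h.ν_family t).continuous_nemytskii
  have h2 := (h.lam_family t).continuous_nemytskii
  have h3 := hL.continuous_nemytskii
  have h4 := continuous_laplacian
  unfold truncField
  fun_prop

/-- The `5 * c` is `4 * c` from the Laplacian plus `c` from `λ`. The factors `e^{-z}` and `e^{z}`
around the nonlinearity cancel, so `L` enters unscaled. -/
lemma norm_truncField_sub_le (h : IsAdmissible ν lam f c β) {R t L : ℝ}
    (hL : IsLipschitzFamily (fun i x => f i (clip R x) t) L) (z : ℝ) (γ v w : EllTwo) :
    ‖truncField ν lam f R t z γ v - truncField ν lam f R t z γ w‖ ≤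
      (5 * c + L + |z|) * ‖v - w‖ := by
  have h1 : ‖nemytskii (fun i x => ν i t * x) (laplacian v) -
      nemytskii (fun i x => ν i t * x) (laplacian w)‖ ≤ c * (4 * ‖v - w‖) := by
    refine ((h.ν_family t).norm_nemytskii_sub_le _ _).trans ?_
    rw [← laplacian_sub]
    exact mul_le_mul_of_nonneg_left (norm_laplacian_le _) h.c_nonneg
  have h2 := (h.lam_family t).norm_nemytskii_sub_le v w
  have h3 : ‖Real.exp (-z) • (nemytskii (fun i x => f i (clip R x) t) (Real.exp z • v) -
      nemytskii (fun i x => f i (clip R x) t) (Real.exp z • w))‖ ≤ L * ‖v - w‖ := by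
    rw [norm_smul, Real.norm_of_nonneg (Real.exp_pos _).le]
    refine (mul_le_mul_of_nonneg_left (hL.norm_nemytskii_sub_le _ _) (Real.exp_pos _).le).trans
      (le_of_eq ?_)
    rw [← smul_sub, norm_smul, Real.norm_of_nonneg (Real.exp_pos _).le, Real.exp_neg]
    field_simp
  have h4 : ‖z • (v - w)‖ ≤ |z| * ‖v - w‖ := by rw [norm_smul, Real.norm_eq_abs]
  have e : truncField ν lam f R t z γ v - truncField ν lam f R t z γ w =
      -(nemytskii (fun i x => ν i t * x) (laplacian v) -
        nemytskii (fun i x => ν i t * x) (laplacian w))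
      - (nemytskii (fun i x => lam i t * x) v - nemytskii (fun i x => lam i t * x) w)
      - Real.exp (-z) • (nemytskii (fun i x => f i (clip R x) t) (Real.exp z • v) -
        nemytskii (fun i x => f i (clip R x) t) (Real.exp z • w)) + z • (v - w) := by
    simp only [truncField, smul_sub]
    abel
  rw [e]
  refine (norm_add_le _ _).trans ?_
  have h5 := norm_sub_le (-(nemytskii (fun i x => ν i t * x) (laplacian v) -
        nemytskii (fun i x => ν i t * x) (laplacian w))
      - (nemytskii (fun i x => lam i t * x) v - nemytskii (fun i x => lam i t * x) w))
      (Real.exp (-z) • (nemytskii (fun i x => f i (clip R x) t) (Real.exp z • v) -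
        nemytskii (fun i x => f i (clip R x) t) (Real.exp z • w)))
  have h6 := norm_sub_le (-(nemytskii (fun i x => ν i t * x) (laplacian v) -
        nemytskii (fun i x => ν i t * x) (laplacian w)))
      (nemytskii (fun i x => lam i t * x) v - nemytskii (fun i x => lam i t * x) w)
  rw [norm_neg] at h6
  linarith

lemma truncField_zero (h : IsAdmissible ν lam f c β) {R t L : ℝ}
    (hL : IsLipschitzFamily (fun i x => f i (clip R x) t) L) (z : ℝ) (γ : EllTwo) :
    truncField ν lam f R t z γ 0 = Real.exp (-z) • γ := by
  have : laplacian 0 = 0 := by simpa using laplacian_sub 0 0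
  simp [truncField, this, (h.ν_family t).nemytskii_zero, (h.lam_family t).nemytskii_zero,
    hL.nemytskii_zero]

open scoped RealInnerProductSpace in
/-- The dissipativity estimate, with constants that do not depend on the truncation. -/
lemma inner_truncField_le (h : IsAdmissible ν lam f c β) {R t L Z G : ℝ} (hR : 0 ≤ R)
    (hL : IsLipschitzFamily (fun i x => f i (clip R x) t) L) {z : ℝ} (hz : |z| ≤ Z) {γ : EllTwo}
    (hγ : ‖γ‖ ≤ G) (v : EllTwo) :
    ⟪v, truncField ν lam f R t z γ v⟫ ≤
      (5 * c + β + Z + 1) * ‖v‖ ^ 2 + (Real.exp Z * G) ^ 2 := by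
  have hv := norm_nonneg v
  have h1 : -⟪v, nemytskii (fun i x => ν i t * x) (laplacian v)⟫ ≤ ‖v‖ * (c * (4 * ‖v‖)) := by
    refine (neg_le_abs _).trans ((abs_real_inner_le_norm _ _).trans ?_)
    refine mul_le_mul_of_nonneg_left (((h.ν_family t).norm_nemytskii_le _).trans ?_) hv
    exact mul_le_mul_of_nonneg_left (norm_laplacian_le _) h.c_nonneg
  have h2 : -⟪v, nemytskii (fun i x => lam i t * x) v⟫ ≤ ‖v‖ * (c * ‖v‖) := by
    refine (neg_le_abs _).trans ((abs_real_inner_le_norm _ _).trans ?_)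
    exact mul_le_mul_of_nonneg_left ((h.lam_family t).norm_nemytskii_le _) hv
  -- The nonlinear term enters only through its one-sided bound, tested against `e^z v`; neither `L`
  -- nor `R` survives.
  have h3 : -(Real.exp (-z) * ⟪v, nemytskii (fun i x => f i (clip R x) t) (Real.exp z • v)⟫) ≤
      β * ‖v‖ ^ 2 := by
    have h3' := hL.neg_mul_le_inner_nemytskii (fun i x => h.f_diss R hR i x t) (Real.exp z • v)
    rw [norm_smul, Real.norm_of_nonneg (Real.exp_pos _).le, real_inner_smul_left] at h3'
    have hp := Real.exp_pos z
    rw [Real.exp_neg]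
    have h3'' : -β * (Real.exp z * ‖v‖ ^ 2) ≤
        ⟪v, nemytskii (fun i x => f i (clip R x) t) (Real.exp z • v)⟫ := by
      refine le_of_mul_le_mul_left ?_ hp
      linarith
    rw [neg_le, ← div_eq_inv_mul, le_div_iff₀ hp]
    linarith
  have h4 : Real.exp (-z) * ⟪v, γ⟫ ≤ ‖v‖ * (Real.exp Z * G) := by
    have hG : 0 ≤ G := (norm_nonneg _).trans hγ
    calc Real.exp (-z) * ⟪v, γ⟫ ≤ Real.exp (-z) * (‖v‖ * ‖γ‖) := by
          gcongr; exact real_inner_le_norm _ _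
      _ ≤ Real.exp Z * (‖v‖ * G) := by
          gcongr; exact (neg_le_abs z).trans hz
      _ = _ := by ring
  have h5 : z * ⟪v, v⟫ ≤ Z * ‖v‖ ^ 2 := by
    rw [real_inner_self_eq_norm_sq]
    gcongr
    exact (le_abs_self z).trans hz
  rw [truncField, inner_add_right, inner_add_right, inner_sub_right, inner_sub_right,
    inner_neg_right, real_inner_smul_right, real_inner_smul_right, real_inner_smul_right]
  nlinarith [sq_nonneg (‖v‖ - Real.exp Z * G), sq_nonneg ‖v‖, sq_nonneg (Real.exp Z * G)]

/-- The truncated field along a noise path and a forcing is a Lipschitz field. -/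
lemma isLipschitzField (h : IsAdmissible ν lam f c β) {R a b L Z G : ℝ} (hab : a ≤ b)
    (hL : ∀ t ∈ Icc a b, IsLipschitzFamily (fun i x => f i (clip R x) t) L)
    {z : ℝ → ℝ} (hz : Continuous z) {g : ℝ → EllTwo} (hg : Continuous g)
    (hZ : ∀ t ∈ Icc a b, |z t| ≤ Z) (hG : ∀ t ∈ Icc a b, ‖g t‖ ≤ G) :
    IsLipschitzField (fun t v => truncField ν lam f R t (z t) (g t) v) a b
      (5 * c + L + Z) (Real.exp Z * G) where
  nonneg := by
    have ha : a ∈ Icc a b := left_mem_Icc.2 hab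
    have := (hL a ha).nonneg
    have := (abs_nonneg _).trans (hZ a ha)
    have := h.c_nonneg
    positivity
  lip t ht x y := by
    refine (h.norm_truncField_sub_le (hL t ht) _ _ _ _).trans ?_
    gcongr
    exact hZ t ht
  bound t ht := by
    rw [h.truncField_zero (hL t ht), norm_smul, Real.norm_of_nonneg (Real.exp_pos _).le]
    gcongr
    exacts [(neg_le_abs _).trans (hZ t ht), hG t ht]
  meas x hx := by
    refine aestronglyMeasurable_of_coord fun i => ?_
    have hν := h.ν_meas i
    have hlam := h.lam_meas i
    have hx' (j : ℤ) : Continuous fun t => x t j := (continuous_coord j).comp hx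
    have hg' : Continuous fun t => g t i := (continuous_coord i).comp hg
    have hf : Continuous fun t => f i (clip R (Real.exp (z t) * x t i)) t :=
      (h.f_cont i).comp (((continuous_clip R).comp
        ((Real.continuous_exp.comp hz).mul (hx' i))).prodMk continuous_id)
    have h1 : AEStronglyMeasurable (fun t => ν i t * (-x t (i - 1) + 2 * x t i - x t (i + 1)))
        volume := hν.mul (Continuous.aestronglyMeasurable (by fun_prop))
    have h2 : AEStronglyMeasurable (fun t => lam i t * x t i) volume :=
      hlam.mul (hx' i).aestronglyMeasurable
    have h3 : Continuous fun t => -(Real.exp (-z t) * f i (clip R (Real.exp (z t) * x t i)) t)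
        + Real.exp (-z t) * g t i + z t * x t i :=
      ((((Real.continuous_exp.comp hz.neg).mul hf).neg).add
        ((Real.continuous_exp.comp hz.neg).mul hg')).add (hz.mul (hx' i))
    -- The coordinate formula is available only for times in `[a, b]`, where the clipped family is
    -- known to be Lipschitz.
    refine (((h1.neg.sub h2).add h3.aestronglyMeasurable).restrict).congr ?_
    filter_upwards [ae_restrict_mem measurableSet_Icc] with t ht
    rw [h.truncField_apply (hL t ht)]
    simp only [coordField, Pi.add_apply, Pi.sub_apply, Pi.neg_apply]
    ring

end IsAdmissible

/-! ### Solutions of the lattice equation for a given noise path -/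

/-- Mild solutions of the lattice equation with noise path `z` and forcing `g`. -/
def IsCoordSolution (ν lam : ℤ → ℝ → ℝ) (f : ℤ → ℝ → ℝ → ℝ) (z : ℝ → ℝ) (g : ℝ → EllTwo) (τ : ℝ)
    (v₀ : EllTwo) (I : Set ℝ) (v : ℝ → EllTwo) : Prop :=
  ContinuousOn v I ∧ v τ = v₀ ∧ ∀ t ∈ I, ∀ i : ℤ,
    IntervalIntegrable (fun s => coordField ν lam f s (z s) (g s) (v s) i) volume τ t ∧
    v t i = v τ i + ∫ s in τ..t, coordField ν lam f s (z s) (g s) (v s) i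

lemma coordField_clip {ν lam : ℤ → ℝ → ℝ} {f : ℤ → ℝ → ℝ → ℝ} {R t z : ℝ} {γ v : EllTwo} {i : ℤ}
    (h : |Real.exp z * v i| ≤ R) :
    coordField ν lam (fun i x t => f i (clip R x) t) t z γ v i = coordField ν lam f t z γ v i := by
  simp only [coordField, clip_eq_self h]

lemma abs_exp_mul_coord_le {z Z M : ℝ} {v : EllTwo} (hz : |z| ≤ Z) (hv : ‖v‖ ≤ M) (i : ℤ) :
    |Real.exp z * v i| ≤ Real.exp Z * M := by
  rw [abs_mul, abs_of_pos (Real.exp_pos z)]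
  gcongr
  · exact (le_abs_self z).trans hz
  · exact (lp.norm_apply_le_norm (by norm_num) v i).trans hv

/-- The a priori bound for solutions on an interval of length `T`. -/
noncomputable def solutionBound (c β Z G V T : ℝ) : ℝ :=
  √(gronwallBound (V ^ 2) (2 * (5 * c + β + Z + 1)) (2 * (Real.exp Z * G) ^ 2) T)

variable {ν lam : ℤ → ℝ → ℝ} {f : ℤ → ℝ → ℝ → ℝ} {c β : ℝ}

namespace IsCoordSolution

variable {z : ℝ → ℝ} {g : ℝ → EllTwo} {τ : ℝ} {v₀ : EllTwo} {I J : Set ℝ} {v : ℝ → EllTwo}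

lemma mono (h : IsCoordSolution ν lam f z g τ v₀ I v) (hJ : J ⊆ I) :
    IsCoordSolution ν lam f z g τ v₀ J v :=
  ⟨h.1.mono hJ, h.2.1, fun t ht => h.2.2 t (hJ ht)⟩

lemma congr (h : IsCoordSolution ν lam f z g τ v₀ I v) {w : ℝ → EllTwo} (hI : OrdConnected I)
    (hτ : τ ∈ I) (hw : EqOn w v I) : IsCoordSolution ν lam f z g τ v₀ I w := by
  refine ⟨h.1.congr hw, (hw hτ).trans h.2.1, fun t ht i => ?_⟩
  have hc : EqOn (fun s => coordField ν lam f s (z s) (g s) (v s) i)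
      (fun s => coordField ν lam f s (z s) (g s) (w s) i) (uIcc τ t) := fun s hs => by
    simp only [hw (hI.uIcc_subset hτ ht hs)]
  obtain ⟨h1, h2⟩ := h.2.2 t ht i
  refine ⟨h1.congr (hc.mono uIoc_subset_uIcc), ?_⟩
  rw [hw ht, hw hτ, h2, intervalIntegral.integral_congr hc]

lemma restart (h : IsCoordSolution ν lam f z g τ v₀ (Ici τ) v) {s : ℝ} (hs : τ ≤ s) :
    IsCoordSolution ν lam f z g s (v s) (Ici s) v := by
  refine ⟨h.1.mono (Ici_subset_Ici.2 hs), rfl, fun t ht i => ?_⟩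
  obtain ⟨h1, h2⟩ := h.2.2 t (hs.trans ht) i
  obtain ⟨h3, h4⟩ := h.2.2 s hs i
  refine ⟨h3.symm.trans h1, ?_⟩
  rw [h2, h4, add_assoc, intervalIntegral.integral_add_adjacent_intervals h3 (h3.symm.trans h1)]

lemma of_forall_Icc (h : ∀ n : ℕ, IsCoordSolution ν lam f z g τ v₀ (Icc τ (τ + n)) v) :
    IsCoordSolution ν lam f z g τ v₀ (Ici τ) v := by
  refine ⟨fun t ht => ?_, (h 0).2.1, fun t ht => ?_⟩
  · obtain ⟨n, hn⟩ := exists_nat_gt (t - τ)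
    refine ((h n).1 t ⟨ht, by linarith⟩).mono_of_mem_nhdsWithin ?_
    exact inter_mem_nhdsWithin _ (Iic_mem_nhds (by linarith))
  · obtain ⟨n, hn⟩ := exists_nat_gt (t - τ)
    exact (h n).2.2 t ⟨ht, by linarith⟩

/-- A mild solution with values in the untruncated region solves the truncated equation in `ℓ²`. -/
lemma isIntegralSolution (h : IsAdmissible ν lam f c β) {b R : ℝ} (hτ : τ ≤ b) (hR : 0 ≤ R)
    (hz : Continuous z) (hg : Continuous g) (hv : IsCoordSolution ν lam f z g τ v₀ (Icc τ b) v)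
    (hb : ∀ s ∈ Icc τ b, ∀ i, |Real.exp (z s) * v s i| ≤ R) :
    IsIntegralSolution (fun t v => truncField ν lam f R t (z t) (g t) v) τ b v₀ v := by
  obtain ⟨L, hL⟩ := h.f_lip R hR τ b
  obtain ⟨Z, hZ⟩ := isCompact_Icc.exists_bound_of_continuousOn (hz.continuousOn (s := Icc τ b))
  obtain ⟨G, hG⟩ := isCompact_Icc.exists_bound_of_continuousOn (hg.continuousOn (s := Icc τ b))
  have hF := h.isLipschitzField hτ hL hz hg hZ hG
  refine ⟨hv.1, fun t ht => ?_⟩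
  ext i
  have hi := hF.intervalIntegrable hv.1 (left_mem_Icc.2 hτ) ht
  rw [lp.coeFn_add, Pi.add_apply, intervalIntegral_coord hi, (hv.2.2 t ht i).2, hv.2.1]
  congr 1
  refine intervalIntegral.integral_congr fun s hs => ?_
  rw [uIcc_of_le ht.1] at hs
  have hs' : s ∈ Icc τ b := ⟨hs.1, hs.2.trans ht.2⟩
  simp only [h.truncField_apply (hL s hs'), coordField_clip (hb s hs' i)]

end IsCoordSolution

/-- A solution of the truncated equation in `ℓ²` with values in the untruncated region is a mild
solution. -/
lemma IsIntegralSolution.isCoordSolution (h : IsAdmissible ν lam f c β) {z : ℝ → ℝ}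
    {g : ℝ → EllTwo} {τ b R : ℝ} {v₀ : EllTwo} {v : ℝ → EllTwo} (hτ : τ ≤ b) (hR : 0 ≤ R)
    (hz : Continuous z) (hg : Continuous g)
    (hv : IsIntegralSolution (fun t v => truncField ν lam f R t (z t) (g t) v) τ b v₀ v)
    (hb : ∀ s ∈ Icc τ b, ∀ i, |Real.exp (z s) * v s i| ≤ R) :
    IsCoordSolution ν lam f z g τ v₀ (Icc τ b) v := by
  obtain ⟨L, hL⟩ := h.f_lip R hR τ b
  obtain ⟨Z, hZ⟩ := isCompact_Icc.exists_bound_of_continuousOn (hz.continuousOn (s := Icc τ b))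
  obtain ⟨G, hG⟩ := isCompact_Icc.exists_bound_of_continuousOn (hg.continuousOn (s := Icc τ b))
  have hF := h.isLipschitzField hτ hL hz hg hZ hG
  have hvτ : v τ = v₀ := by simpa using hv.eq τ (left_mem_Icc.2 hτ)
  refine ⟨hv.cont, hvτ, fun t ht i => ?_⟩
  have hi := hF.intervalIntegrable hv.cont (left_mem_Icc.2 hτ) ht
  have hc : EqOn (fun s => truncField ν lam f R s (z s) (g s) (v s) i)
      (fun s => coordField ν lam f s (z s) (g s) (v s) i) (uIcc τ t) := fun s hs => by
    rw [uIcc_of_le ht.1] at hs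
    have hs' : s ∈ Icc τ b := ⟨hs.1, hs.2.trans ht.2⟩
    simp only [h.truncField_apply (hL s hs'), coordField_clip (hb s hs' i)]
  refine ⟨(intervalIntegrable_coord hi i).congr (hc.mono uIoc_subset_uIcc), ?_⟩
  rw [← intervalIntegral.integral_congr hc, ← intervalIntegral_coord hi, hvτ, ← Pi.add_apply,
    ← lp.coeFn_add, ← hv.eq t ht]

namespace IsAdmissible

section Fixed

variable {z : ℝ → ℝ} {g : ℝ → EllTwo} {τ b Z G V : ℝ} {v₀ : EllTwo}

/-- The energy estimate needs some bound on the field along `v`, which may depend on `R`, but that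
bound does not enter its conclusion. -/
lemma norm_le_solutionBound (h : IsAdmissible ν lam f c β) {R : ℝ} (hR : 0 ≤ R)
    (hz : Continuous z) (hg : Continuous g) (hZ : ∀ t ∈ Icc τ b, |z t| ≤ Z)
    (hG : ∀ t ∈ Icc τ b, ‖g t‖ ≤ G) (hV : ‖v₀‖ ≤ V) {v : ℝ → EllTwo}
    (hv : IsIntegralSolution (fun t v => truncField ν lam f R t (z t) (g t) v) τ b v₀ v) :
    ∀ t ∈ Icc τ b, ‖v t‖ ≤ solutionBound c β Z G V (b - τ) := by
  intro t ht
  have hτ : τ ≤ b := ht.1.trans ht.2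
  obtain ⟨L, hL⟩ := h.f_lip R hR τ b
  have hF := h.isLipschitzField hτ hL hz hg hZ hG
  obtain ⟨M, hM⟩ := isCompact_Icc.exists_bound_of_continuousOn hv.cont
  have h1 := norm_sq_le_gronwallBound (pow_le_pow_left₀ (norm_nonneg _) hV 2) hv.cont
    (hF.integrableOn hv.cont)
    (fun t ht => (hF.norm_le ht (v t)).trans
      (add_le_add_left (mul_le_mul_of_nonneg_left (hM t ht) hF.nonneg) _)) hv.eq
    (fun t ht => h.inner_truncField_le hR (hL t ht) (hZ t ht) (hG t ht) (v t)) t ht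
  have hZ0 : 0 ≤ Z := (abs_nonneg _).trans (hZ t ht)
  have hc := h.c_nonneg
  have hβ := h.β_nonneg
  refine Real.le_sqrt_of_sq_le (h1.trans ?_)
  exact gronwallBound_mono (by positivity) (by positivity) (by positivity)
    (sub_le_sub_right ht.2 τ)

/-- A mild solution on a compact interval solves the truncated equation, with a truncation that
depends only on the bounds for the data. -/
lemma isIntegralSolution_of_isCoordSolution (h : IsAdmissible ν lam f c β) (hτ : τ ≤ b)
    (hz : Continuous z) (hg : Continuous g) (hZ : ∀ t ∈ Icc τ b, |z t| ≤ Z)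
    (hG : ∀ t ∈ Icc τ b, ‖g t‖ ≤ G) (hV : ‖v₀‖ ≤ V) {v : ℝ → EllTwo}
    (hv : IsCoordSolution ν lam f z g τ v₀ (Icc τ b) v) :
    IsIntegralSolution (fun t v => truncField ν lam f
      (Real.exp Z * solutionBound c β Z G V (b - τ)) t (z t) (g t) v) τ b v₀ v := by
  obtain ⟨M, hM⟩ := isCompact_Icc.exists_bound_of_continuousOn hv.1
  have hM0 : 0 ≤ M := (norm_nonneg _).trans (hM τ (left_mem_Icc.2 hτ))
  -- The solution is first clipped at its own unknown supremum; the resulting a priori bound then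
  -- allows clipping at the level fixed by the data.
  have hv1 := hv.isIntegralSolution h hτ (R := Real.exp Z * M) (by positivity) hz hg
    fun s hs => abs_exp_mul_coord_le (hZ s hs) (hM s hs)
  have hb := h.norm_le_solutionBound (by positivity) hz hg hZ hG hV hv1
  exact hv.isIntegralSolution h hτ (mul_nonneg (Real.exp_pos _).le (Real.sqrt_nonneg _)) hz hg
    fun s hs => abs_exp_mul_coord_le (hZ s hs) (hb s hs)

/-- Since the a priori bound is independent of `R`, it can be used to choose `R`; the clipping is
then inactive along the solution. -/
lemma exists_isCoordSolution_Icc (h : IsAdmissible ν lam f c β) (hτ : τ ≤ b)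
    (hz : Continuous z) (hg : Continuous g) (v₀ : EllTwo) :
    ∃ v, IsCoordSolution ν lam f z g τ v₀ (Icc τ b) v := by
  obtain ⟨Z, hZ⟩ := isCompact_Icc.exists_bound_of_continuousOn (hz.continuousOn (s := Icc τ b))
  obtain ⟨G, hG⟩ := isCompact_Icc.exists_bound_of_continuousOn (hg.continuousOn (s := Icc τ b))
  have hR : 0 ≤ Real.exp Z * solutionBound c β Z G ‖v₀‖ (b - τ) :=
    mul_nonneg (Real.exp_pos _).le (Real.sqrt_nonneg _)
  obtain ⟨L, hL⟩ := h.f_lip _ hR τ b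
  obtain ⟨v, hv⟩ := (h.isLipschitzField hτ hL hz hg hZ hG).exists_isIntegralSolution hτ v₀
  have hb := h.norm_le_solutionBound hR hz hg hZ hG le_rfl hv
  exact ⟨v, hv.isCoordSolution h hτ hR hz hg
    fun s hs => abs_exp_mul_coord_le (hZ s hs) (hb s hs)⟩

lemma eqOn_Icc (h : IsAdmissible ν lam f c β) (hτ : τ ≤ b) (hz : Continuous z)
    (hg : Continuous g) {v w : ℝ → EllTwo} (hv : IsCoordSolution ν lam f z g τ v₀ (Icc τ b) v)
    (hw : IsCoordSolution ν lam f z g τ v₀ (Icc τ b) w) : EqOn v w (Icc τ b) := by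
  obtain ⟨Z, hZ⟩ := isCompact_Icc.exists_bound_of_continuousOn (hz.continuousOn (s := Icc τ b))
  obtain ⟨G, hG⟩ := isCompact_Icc.exists_bound_of_continuousOn (hg.continuousOn (s := Icc τ b))
  have hv' := h.isIntegralSolution_of_isCoordSolution hτ hz hg hZ hG le_rfl hv
  have hw' := h.isIntegralSolution_of_isCoordSolution hτ hz hg hZ hG le_rfl hw
  obtain ⟨L, hL⟩ := h.f_lip (Real.exp Z * solutionBound c β Z G ‖v₀‖ (b - τ))
    (mul_nonneg (Real.exp_pos _).le (Real.sqrt_nonneg _)) τ b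
  have hF := h.isLipschitzField hτ hL hz hg hZ hG
  intro t ht
  have := norm_sub_le_of_isIntegralSolution hF hF hv' hw' t ht
  simp only [sub_self, norm_zero, intervalIntegral.integral_zero, add_zero, zero_mul] at this
  exact sub_eq_zero.1 (norm_le_zero_iff.1 this)

lemma exists_isCoordSolution_Ici (h : IsAdmissible ν lam f c β) (hz : Continuous z)
    (hg : Continuous g) (τ : ℝ) (v₀ : EllTwo) :
    ∃ v, IsCoordSolution ν lam f z g τ v₀ (Ici τ) v := by
  have hn (n : ℕ) : τ ≤ τ + n := by simp
  choose w hw using fun n : ℕ => h.exists_isCoordSolution_Icc (hn n) hz hg v₀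
  have hmn {m n : ℕ} (hmn : m ≤ n) : EqOn (w m) (w n) (Icc τ (τ + m)) :=
    h.eqOn_Icc (hn m) hz hg (hw m)
      ((hw n).mono (Icc_subset_Icc_right (by simpa using hmn)))
  -- At time `t` the value comes from the shortest interval `[τ, τ + n]` containing `t`; uniqueness
  -- makes all longer ones agree with it.
  refine ⟨fun t => w ⌈t - τ⌉₊ t, IsCoordSolution.of_forall_Icc fun n =>
    (hw n).congr ordConnected_Icc (left_mem_Icc.2 (hn n)) fun t ht => ?_⟩
  refine hmn (Nat.ceil_le.2 (by linarith [ht.2])) ⟨ht.1, ?_⟩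
  linarith [Nat.le_ceil (t - τ)]

end Fixed

end IsAdmissible

open Classical in
/-- The solution of the lattice equation with noise path `z`, forcing `g` and initial value `v₀` at
time `τ`. -/
noncomputable def solution (ν lam : ℤ → ℝ → ℝ) (f : ℤ → ℝ → ℝ → ℝ) (z : ℝ → ℝ) (g : ℝ → EllTwo)
    (τ : ℝ) (v₀ : EllTwo) : ℝ → EllTwo :=
  if h : ∃ v, IsCoordSolution ν lam f z g τ v₀ (Ici τ) v then h.choose else 0

namespace IsAdmissible

section Fixed

variable {z : ℝ → ℝ} {g : ℝ → EllTwo} {τ : ℝ} {v₀ : EllTwo}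

lemma isCoordSolution_solution (h : IsAdmissible ν lam f c β) (hz : Continuous z)
    (hg : Continuous g) (τ : ℝ) (v₀ : EllTwo) :
    IsCoordSolution ν lam f z g τ v₀ (Ici τ) (solution ν lam f z g τ v₀) := by
  have := h.exists_isCoordSolution_Ici hz hg τ v₀
  rw [solution, dif_pos this]
  exact this.choose_spec

lemma eq_solution (h : IsAdmissible ν lam f c β) (hz : Continuous z) (hg : Continuous g)
    {w : ℝ → EllTwo} {t : ℝ} (ht : τ ≤ t) (hw : IsCoordSolution ν lam f z g τ v₀ (Icc τ t) w) :
    w t = solution ν lam f z g τ v₀ t :=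
  h.eqOn_Icc ht hz hg hw ((h.isCoordSolution_solution hz hg τ v₀).mono Icc_subset_Ici_self)
    (right_mem_Icc.2 ht)

lemma solution_self (h : IsAdmissible ν lam f c β) (hz : Continuous z) (hg : Continuous g)
    (τ : ℝ) (v₀ : EllTwo) : solution ν lam f z g τ v₀ τ = v₀ :=
  (h.isCoordSolution_solution hz hg τ v₀).2.1

lemma solution_solution (h : IsAdmissible ν lam f c β) (hz : Continuous z) (hg : Continuous g)
    {s t : ℝ} (hs : τ ≤ s) (ht : s ≤ t) :
    solution ν lam f z g τ v₀ t = solution ν lam f z g s (solution ν lam f z g τ v₀ s) t :=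
  h.eq_solution hz hg ht
    (((h.isCoordSolution_solution hz hg τ v₀).restart hs).mono Icc_subset_Ici_self)

end Fixed

/-- The solution depends continuously on the noise path, the initial value and the forcing. -/
theorem continuous_solution (h : IsAdmissible ν lam f c β) {τ t : ℝ} (ht : τ ≤ t) :
    Continuous fun p : C(ℝ, ℝ) × EllTwo × (ℝ →ᵇ EllTwo) =>
      solution ν lam f p.1 p.2.2 τ p.2.1 t := by
  refine continuous_iff_continuousAt.2 fun p₀ => ?_
  obtain ⟨Z, hZ⟩ := isCompact_Icc.exists_bound_of_continuousOn
    (p₀.1.continuous.continuousOn (s := Icc τ t))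
  have hτ : τ ∈ Icc τ t := left_mem_Icc.2 ht
  have htt : t ∈ Icc τ t := right_mem_Icc.2 ht
  -- The slack of `1` in all three bounds makes them hold on a neighbourhood of `p₀`, so one level
  -- `R` serves every nearby problem.
  set G := ‖p₀.2.2‖ + 1
  set V := ‖p₀.2.1‖ + 1
  have hev : ∀ᶠ p in 𝓝 p₀, (∀ s ∈ Icc τ t, |p.1 s| ≤ Z + 1) ∧ (∀ s ∈ Icc τ t, ‖p.2.2 s‖ ≤ G) ∧
      ‖p.2.1‖ ≤ V := by
    have h1 : ∀ᶠ z : C(ℝ, ℝ) in 𝓝 p₀.1, MapsTo z (Icc τ t) (Ioo (-(Z + 1)) (Z + 1)) := by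
      refine (ContinuousMap.isOpen_setOfPred_mapsTo isCompact_Icc isOpen_Ioo).mem_nhds fun s hs => ?_
      exact abs_lt.1 ((hZ s hs).trans_lt (lt_add_one Z))
    have h2 : ∀ᶠ p in 𝓝 p₀, ‖p.2.2‖ < G :=
      (by fun_prop : Continuous fun p : C(ℝ, ℝ) × EllTwo × (ℝ →ᵇ EllTwo) => ‖p.2.2‖).continuousAt
        |>.eventually_lt_const (lt_add_one _)
    have h3 : ∀ᶠ p in 𝓝 p₀, ‖p.2.1‖ < V :=
      (by fun_prop : Continuous fun p : C(ℝ, ℝ) × EllTwo × (ℝ →ᵇ EllTwo) => ‖p.2.1‖).continuousAt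
        |>.eventually_lt_const (lt_add_one _)
    filter_upwards [continuous_fst.continuousAt.eventually h1, h2, h3] with p hp1 hp2 hp3
    exact ⟨fun s hs => (abs_lt.2 (hp1 hs)).le,
      fun s _ => (p.2.2.norm_coe_le_norm s).trans hp2.le, hp3.le⟩
  set R := Real.exp (Z + 1) * solutionBound c β (Z + 1) G V (t - τ)
  have hR : 0 ≤ R := mul_nonneg (Real.exp_pos _).le (Real.sqrt_nonneg _)
  obtain ⟨L, hL⟩ := h.f_lip R hR τ t
  let F (p : C(ℝ, ℝ) × EllTwo × (ℝ →ᵇ EllTwo)) (s : ℝ) (v : EllTwo) : EllTwo :=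
    truncField ν lam f R s (p.1 s) (p.2.2 s) v
  have hF : ∀ᶠ p in 𝓝 p₀, IsLipschitzField (F p) τ t (5 * c + L + (Z + 1))
      (Real.exp (Z + 1) * G) := by
    filter_upwards [hev] with p hp
    exact h.isLipschitzField ht hL p.1.continuous p.2.2.continuous hp.1 hp.2.1
  have hsol : ∀ᶠ p in 𝓝 p₀, IsIntegralSolution (F p) τ t p.2.1
      (solution ν lam f p.1 p.2.2 τ p.2.1) := by
    filter_upwards [hev] with p hp
    exact h.isIntegralSolution_of_isCoordSolution ht p.1.continuous p.2.2.continuous hp.1 hp.2.1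
      hp.2.2 ((h.isCoordSolution_solution p.1.continuous p.2.2.continuous τ _).mono
        Icc_subset_Ici_self)
  have hF₀ := hF.self_of_nhds
  have hs₀ := hsol.self_of_nhds
  set v := solution ν lam f p₀.1 p₀.2.2 τ p₀.2.1
  obtain ⟨B, hB⟩ := isCompact_Icc.exists_bound_of_continuousOn hs₀.cont
  -- Along the fixed curve `v` the fields converge for each time in the interval and share a
  -- constant bound.
  have hint : Tendsto (fun p => ∫ s in τ..t, ‖F p s (v s) - F p₀ s (v s)‖) (𝓝 p₀) (𝓝 0) := by
    have hlim := intervalIntegral.tendsto_integral_filter_of_dominated_convergence (μ := volume)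
      (a := τ) (b := t) (l := 𝓝 p₀) (F := fun p s => ‖F p s (v s) - F p₀ s (v s)‖)
      (f := fun _ => 0)
      (fun _ => 2 * ((5 * c + L + (Z + 1)) * B + Real.exp (Z + 1) * G)) ?_ ?_ ?_ ?_
    · simpa using hlim
    · filter_upwards [hF] with p hp
      exact ((hp.intervalIntegrable hs₀.cont hτ htt).sub
        (hF₀.intervalIntegrable hs₀.cont hτ htt)).norm.def'.aestronglyMeasurable
    · filter_upwards [hF] with p hp
      refine ae_of_all _ fun s hs => ?_
      rw [uIoc_of_le ht] at hs
      have hs' := Ioc_subset_Icc_self hs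
      have b0 := mul_le_mul_of_nonneg_left (hB s hs') hp.nonneg
      rw [norm_norm]
      refine (norm_sub_le _ _).trans ?_
      linarith [hp.norm_le hs' (v s), hF₀.norm_le hs' (v s)]
    · exact intervalIntegrable_const
    · refine ae_of_all _ fun s hs => ?_
      rw [uIoc_of_le ht] at hs
      have hc : Continuous fun p => F p s (v s) := by
        refine (h.continuous_truncField (hL s (Ioc_subset_Icc_self hs))).comp
          (f := fun p : C(ℝ, ℝ) × EllTwo × (ℝ →ᵇ EllTwo) => (p.1 s, p.2.2 s, v s)) ?_
        exact ((continuous_eval_const s).comp continuous_fst).prodMk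
          (((continuous_eval_const s).comp
            (continuous_snd.comp continuous_snd)).prodMk continuous_const)
      exact tendsto_iff_norm_sub_tendsto_zero.1 (hc.tendsto p₀)
  have hv₀ : Tendsto (fun p : C(ℝ, ℝ) × EllTwo × (ℝ →ᵇ EllTwo) => ‖p.2.1 - p₀.2.1‖)
      (𝓝 p₀) (𝓝 0) := by
    have : Continuous fun p : C(ℝ, ℝ) × EllTwo × (ℝ →ᵇ EllTwo) => ‖p.2.1 - p₀.2.1‖ := by fun_prop
    simpa using this.tendsto p₀
  have hbound := (hv₀.add hint).mul_const (Real.exp ((5 * c + L + (Z + 1)) * (t - τ)))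
  rw [add_zero, zero_mul] at hbound
  refine tendsto_iff_norm_sub_tendsto_zero.2
    (squeeze_zero' (Eventually.of_forall fun _ => norm_nonneg _) ?_ hbound)
  filter_upwards [hF, hsol] with p hp hps
  exact norm_sub_le_of_isIntegralSolution hp hF₀ hps hs₀ t htt

end IsAdmissible

/-! ### The Borel structure of the path space -/

/-- The Borel σ-algebra of the compact-open topology is generated by the evaluations. -/
lemma measurable_of_forall_eval {α : Type*} {m : MeasurableSpace α} {h : α → C(ℝ, ℝ)}
    (hh : ∀ t, Measurable fun a => h a t) : Measurable[m, borel C(ℝ, ℝ)] h := by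
  rw [borel_eq_generateFrom_of_subbasis ContinuousMap.compactOpen_eq]
  refine measurable_generateFrom ?_
  rintro _ ⟨K, hK, U, hU, rfl⟩
  replace hK : IsCompact K := hK
  replace hU : IsOpen U := hU
  obtain ⟨D, hDK, hDc, hD⟩ := hK.isSeparable.exists_countable_dense_subset
  -- A compact image inside `U` keeps a positive distance from `Uᶜ`. This is a closed condition for
  -- each fixed `n`, so it may be tested on a countable dense subset of `K`.
  have key : h ⁻¹' {φ : C(ℝ, ℝ) | MapsTo φ K U} =
      ⋃ n : ℕ, ⋂ x ∈ D, {a | h a x ∈ (Metric.thickening (1 / (n + 1 : ℝ)) Uᶜ)ᶜ} := by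
    ext a
    simp only [mem_preimage, mem_ofPred_eq, mem_iUnion, mem_iInter]
    constructor
    · intro hKU
      obtain ⟨δ, hδ, hδU⟩ := (hK.image (h a).continuous).exists_thickening_subset_open hU
        hKU.image_subset
      obtain ⟨n, hn⟩ := exists_nat_one_div_lt hδ
      refine ⟨n, fun x hx hmem => ?_⟩
      obtain ⟨w, hw, hxw⟩ := Metric.mem_thickening_iff.1 hmem
      refine hw (hδU (Metric.mem_thickening_iff.2 ⟨h a x, mem_image_of_mem _ (hDK hx), ?_⟩))
      rw [dist_comm]
      exact hxw.trans hn
    · rintro ⟨n, hn⟩ x hx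
      have hcl : IsClosed ((h a) ⁻¹' (Metric.thickening (1 / (n + 1 : ℝ)) Uᶜ)ᶜ) :=
        Metric.isOpen_thickening.isClosed_compl.preimage (h a).continuous
      have hx' := closure_minimal hn hcl (hD hx)
      by_contra hxU
      exact hx' (Metric.self_subset_thickening (by positivity) _ hxU)
  rw [key]
  exact .iUnion fun n => .biInter hDc fun x _ =>
    hh x Metric.isOpen_thickening.isClosed_compl.measurableSet

lemma measurable_pathSpace_of_forall_eval {α : Type*} {m : MeasurableSpace α} {h : α → PathSpace}
    (hh : ∀ t, Measurable fun a => (h a).1 t) : Measurable h := by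
  have := @measurable_comap_iff _ _ _ m (borel C(ℝ, ℝ)) h Subtype.val |>.2
    (measurable_of_forall_eval hh)
  rwa [← borel_comap] at this

lemma continuous_pathEval (t : ℝ) : Continuous fun ω : PathSpace => ω.1 t :=
  (continuous_eval_const t).comp continuous_subtype_val

lemma measurable_pathEval : Measurable fun (ω : PathSpace) (t : ℝ) => ω.1 t :=
  measurable_pi_lambda _ fun t => (continuous_pathEval t).measurable

/-- Measures on the path space are determined by the law of the coordinate process. -/
lemma pathSpace_measure_ext {P Q : Measure PathSpace}
    (h : P.map (fun ω t => ω.1 t) = Q.map fun ω t => ω.1 t) : P = Q := by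
  have hle : borel PathSpace ≤
      MeasurableSpace.comap (fun (ω : PathSpace) (t : ℝ) => ω.1 t) inferInstance := by
    have := measurable_pathSpace_of_forall_eval
      (m := MeasurableSpace.comap (fun (ω : PathSpace) (t : ℝ) => ω.1 t) inferInstance) (h := id)
      fun t => (measurable_pi_apply t).comp
        (comap_measurable (fun (ω : PathSpace) (t : ℝ) => ω.1 t))
    exact fun s hs => this hs
  refine Measure.ext fun s hs => ?_
  obtain ⟨B, hB, rfl⟩ := hle s hs
  rw [← Measure.map_apply measurable_pathEval hB, h, Measure.map_apply measurable_pathEval hB]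

lemma continuous_wienerShift : Continuous fun p : ℝ × PathSpace => wienerShift p.1 p.2 := by
  refine Continuous.subtype_mk (ContinuousMap.continuous_of_continuous_uncurry _ ?_) _
  have h1 : Continuous fun q : (ℝ × PathSpace) × ℝ => q.1.2.1 (q.2 + q.1.1) :=
    continuous_eval.comp
      ((continuous_subtype_val.comp (continuous_snd.comp continuous_fst)).prodMk
        (continuous_snd.add (continuous_fst.comp continuous_fst)))
  have h2 : Continuous fun q : (ℝ × PathSpace) × ℝ => q.1.2.1 q.1.1 :=
    continuous_eval.comp
      ((continuous_subtype_val.comp (continuous_snd.comp continuous_fst)).prodMk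
        (continuous_fst.comp continuous_fst))
  exact h1.sub h2

lemma continuous_shift : Continuous fun p : ℝ × Tempered => shift p.1 p.2 :=
  (continuous_wienerShift.comp
    (continuous_fst.prodMk (continuous_subtype_val.comp continuous_snd))).subtype_mk _

lemma isGroupOfMaps_shift : IsGroupOfMaps shift where
  zero ω := by
    refine Subtype.ext (Subtype.ext (ContinuousMap.ext fun s => ?_))
    change ω.1.1 (s + 0) - ω.1.1 0 = ω.1.1 s
    rw [add_zero, ω.1.2, sub_zero]
  add s t ω := by
    refine Subtype.ext (Subtype.ext (ContinuousMap.ext fun r => ?_))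
    change ω.1.1 (r + (s + t)) - ω.1.1 (s + t) =
      (ω.1.1 (r + t + s) - ω.1.1 s) - (ω.1.1 (t + s) - ω.1.1 s)
    rw [add_comm t s, add_right_comm, add_assoc r s t]
    ring

/-- Tolerances `1 / (k + 1)` and integer thresholds suffice. The remaining uncountable intersection
over `t` is one of closed sets, hence closed. -/
lemma measurableSet_temperedPaths : MeasurableSet temperedPaths := by
  have key (l : ℝ → ℝ) (L : Filter ℝ) (hL : L.HasBasis (fun _ : ℕ => True) fun n => {t | n ≤ l t}) :
      MeasurableSet {ω : PathSpace | Tendsto (fun t => |ω.1 t| / |t|) L (𝓝 0)} := by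
    have e : {ω : PathSpace | Tendsto (fun t => |ω.1 t| / |t|) L (𝓝 0)} =
        ⋂ k : ℕ, ⋃ n : ℕ, ⋂ t ∈ {t : ℝ | (n : ℝ) ≤ l t},
          {ω : PathSpace | |ω.1 t| / |t| ≤ 1 / (k + 1)} := by
      ext ω
      simp only [mem_ofPred_eq, mem_iInter, mem_iUnion]
      rw [(hL.tendsto_iff Metric.nhds_basis_closedBall)]
      simp only [mem_ofPred_eq, Metric.mem_closedBall, Real.dist_0_eq_abs, abs_div, abs_abs,
        true_and]
      constructor
      · exact fun h k => h _ (by positivity)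
      · intro h ε hε
        obtain ⟨k, hk⟩ := exists_nat_one_div_lt hε
        obtain ⟨n, hn⟩ := h k
        exact ⟨n, fun t ht => (hn t ht).trans hk.le⟩
    rw [e]
    refine .iInter fun k => .iUnion fun n => (isClosed_biInter fun t _ => ?_).measurableSet
    exact isClosed_le ((continuous_pathEval t).abs.div_const _) continuous_const
  refine (key id atTop ?_).inter (key (fun t => -t) atBot ?_)
  · exact atTop_basis.to_hasBasis (fun x _ => (exists_nat_ge x).imp fun n hn =>
      ⟨trivial, fun t ht => hn.trans ht⟩) fun n _ => ⟨n, trivial, fun t ht => ht⟩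
  · exact atBot_basis.to_hasBasis (fun x _ => (exists_nat_ge (-x)).imp fun n hn =>
      ⟨trivial, fun _ ht => by
        simp only [mem_ofPred_eq, mem_Iic] at *
        linarith⟩) fun n _ => ⟨-n, trivial, fun _ ht => by
        simp only [mem_ofPred_eq, mem_Iic] at *
        linarith⟩

/-! ### Brownian paths are of sublinear growth -/

/-- The strong law of large numbers for Brownian motion, by time inversion. -/
lemma tendsto_abs_div_of_isPreBrownianReal {Ω : Type*} {m : MeasurableSpace Ω} {P : Measure Ω}
    {B : ℝ≥0 → Ω → ℝ} (hB : IsPreBrownianReal B P) (hm : ∀ t, Measurable (B t))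
    (hc : ∀ ω, Continuous fun t => B t ω) (h0 : ∀ ω, B 0 ω = 0) :
    ∀ᵐ ω ∂P, Tendsto (fun t : ℝ≥0 => |B t ω| / t) atTop (𝓝 0) := by
  have hprob := hB.isGaussianProcess.isProbabilityMeasure
  let d := TopologicalSpace.denseSeq ℝ≥0
  -- Smallness near `0` is tested only along a countable dense set, so `S` is measurable in the
  -- product σ-algebra and its probability depends only on finite-dimensional laws.
  let S : Set (ℝ≥0 → ℝ) := {x | ∀ k : ℕ, ∃ m : ℕ, ∀ j : ℕ, d j < 1 / (m + 1) →
    |x (d j)| ≤ 1 / (k + 1)}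
  have hS : MeasurableSet S := by
    have e : S = ⋂ k : ℕ, ⋃ m : ℕ, ⋂ j : ℕ,
        {x : ℝ≥0 → ℝ | d j < 1 / (m + 1) → |x (d j)| ≤ 1 / (k + 1 : ℝ)} := by
      ext x
      simp only [S, mem_ofPred_eq, mem_iInter, mem_iUnion]
    rw [e]
    refine .iInter fun k => .iUnion fun m => .iInter fun j => ?_
    by_cases hj : d j < 1 / (m + 1)
    · simp only [hj, true_imp_iff]
      exact measurableSet_le (measurable_pi_apply (d j)).abs measurable_const
    · simp only [hj, false_imp_iff]
      exact .const True
  have hBS (ω : Ω) : (fun t => B t ω) ∈ S := by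
    intro k
    have hlt : ∀ᶠ t in 𝓝 0, |B t ω| < 1 / (k + 1) := by
      refine (hc ω).abs.continuousAt.eventually_lt_const ?_
      simp only [h0, abs_zero]
      positivity
    obtain ⟨ε, hε, hball⟩ := Metric.eventually_nhds_iff.1 hlt
    obtain ⟨m, hm⟩ := exists_nat_one_div_lt hε
    refine ⟨m, fun j hj => (hball ?_).le⟩
    rw [NNReal.dist_eq, NNReal.coe_zero, sub_zero, NNReal.abs_eq]
    refine lt_trans ?_ hm
    exact_mod_cast hj
  have hmB : Measurable fun ω t => B t ω := measurable_pi_lambda _ hm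
  have hmY : Measurable fun ω (t : ℝ≥0) => t * B (1 / t) ω :=
    measurable_pi_lambda _ fun t => (hm _).const_mul _
  -- Time inversion preserves the law, so the inverted process is almost surely small near `0`,
  -- which says that `B t / t` is small at infinity.
  have hlaw : P.map (fun ω t => B t ω) = P.map fun ω (t : ℝ≥0) => t * B (1 / t) ω := by
    refine (map_eq_iff_forall_finset_map_restrict_eq hmB.aemeasurable hmY.aemeasurable).2
      fun I => ?_
    rw [(hB.hasLaw I).map_eq, (hB.inv.hasLaw I).map_eq]
  have hY : ∀ᵐ ω ∂P, (fun t : ℝ≥0 => t * B (1 / t) ω) ∈ S := by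
    refine (ae_map_iff (p := (· ∈ S)) hmY.aemeasurable hS).1 ?_
    rw [← hlaw]
    exact (ae_map_iff hmB.aemeasurable hS).2 (ae_of_all _ hBS)
  filter_upwards [hY] with ω hω
  rw [Metric.tendsto_atTop]
  intro ε hε
  obtain ⟨k, hk⟩ := exists_nat_one_div_lt hε
  obtain ⟨m, hm⟩ := hω k
  have hle : ∀ t : ℝ≥0, t ∈ Ioo (0 : ℝ≥0) (1 / (m + 1)) → |t * B (1 / t) ω| ≤ 1 / (k + 1) := by
    intro t ht
    by_contra! hgt
    have hct : ContinuousAt (fun t : ℝ≥0 => |t * B (1 / t) ω|) t := by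
      refine ContinuousAt.abs (NNReal.continuous_coe.continuousAt.mul ?_)
      refine (hc ω).continuousAt.comp (f := fun t : ℝ≥0 => 1 / t) ?_
      exact continuousAt_const.div continuousAt_id ht.1.ne'
    have hev := (hct.eventually_const_lt hgt).and (Ioo_mem_nhds ht.1 ht.2)
    obtain ⟨U, hU, hUo, htU⟩ := eventually_nhds_iff.1 hev
    obtain ⟨j, hyU⟩ := (TopologicalSpace.denseRange_denseSeq ℝ≥0).exists_mem_open hUo ⟨t, htU⟩
    exact absurd (hm _ (hU _ hyU).2.2) (not_le.2 (hU _ hyU).1)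
  -- From `s ≥ m + 2` one gets the strict inequality `1 / s < 1 / (m + 1)`.
  refine ⟨m + 2, fun s hs => ?_⟩
  have hs0 : 0 < s := lt_of_lt_of_le (by positivity) hs
  have := hle (1 / s) ⟨by positivity, one_div_lt_one_div_of_lt (by positivity)
    (lt_of_lt_of_le (by norm_num) hs)⟩
  rw [Real.dist_0_eq_abs, abs_div, abs_abs, NNReal.abs_eq]
  rw [one_div_one_div, abs_mul, NNReal.abs_eq, NNReal.coe_div, NNReal.coe_one,
    one_div_mul_eq_div] at this
  exact this.trans_lt hk

namespace IsWienerMeasure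

variable {P : Measure PathSpace}

lemma isProbabilityMeasure (hP : IsWienerMeasure P) : IsProbabilityMeasure P :=
  (hP.law 0 0).isProbabilityMeasure

lemma isPreBrownianReal_shift (hP : IsWienerMeasure P) (a : ℝ) :
    IsPreBrownianReal (fun (u : ℝ≥0) (ω : PathSpace) => ω.1 (u + a) - ω.1 a) P := by
  refine HasIndepIncrements.isPreBrownianReal_of_hasLaw (fun t => ?_) fun n t ht => ?_
  · convert hP.law a (t + a) using 2
    ext
    simp
  · convert hP.indep n (fun i => (t i : ℝ) + a) (fun i j hij => by
      simpa using ht hij) using 2 with i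
    ext ω
    ring

/-- Reflecting time reverses the order of a partition: the increments are reindexed by `Fin.rev` and
change sign, and both operations preserve independence. -/
lemma isPreBrownianReal_neg (hP : IsWienerMeasure P) :
    IsPreBrownianReal (fun (u : ℝ≥0) (ω : PathSpace) => ω.1 (-u)) P := by
  refine HasIndepIncrements.isPreBrownianReal_of_hasLaw (fun t => ?_) fun n t ht => ?_
  · have h := hP.law 0 (-t)
    have e1 : nndist 0 (-t : ℝ) = t := by ext; simp
    have e2 : (fun ω : PathSpace => ω.1 (-t) - ω.1 0) = fun ω => ω.1 (-t) := by
      ext ω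
      rw [ω.2, sub_zero]
    rwa [e1, e2] at h
  · have h := hP.indep n (fun i => -(t i.rev : ℝ)) fun i j hij => by
      have := ht (Fin.rev_le_rev.2 hij)
      simpa using this
    have h' := (h.precomp Fin.rev_injective).comp (fun _ x => -x) fun _ => measurable_neg
    convert h' using 2 with i
    ext ω
    simp [Fin.rev_succ, Fin.rev_castSucc]

/-- For finitely many times choose `a ≤ 0` to their left. The increments from `a` and from `a + t`
are one-sided Brownian motions of the same law. The functional `Ψ`, value at `s - a` minus value at
`-a`, recovers from them the coordinates of `ω` and of its shift. -/
lemma map_wienerShift (hP : IsWienerMeasure P) (t : ℝ) : P.map (wienerShift t) = P := by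
  have hprob := hP.isProbabilityMeasure
  have hmt : Measurable (wienerShift t) :=
    (continuous_wienerShift.comp (continuous_const.prodMk continuous_id)).measurable
  have hme (s : ℝ) : Measurable fun ω : PathSpace => ω.1 s := (continuous_pathEval s).measurable
  refine pathSpace_measure_ext ?_
  rw [Measure.map_map measurable_pathEval hmt]
  refine (map_eq_iff_forall_finset_map_restrict_eq
    (X := fun (s : ℝ) (ω : PathSpace) => (wienerShift t ω).1 s) (Y := fun s ω => ω.1 s)
    (measurable_pathEval.comp hmt).aemeasurable measurable_pathEval.aemeasurable).2 fun I => ?_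
  obtain ⟨a, ha0, haI⟩ : ∃ a : ℝ, a ≤ 0 ∧ ∀ s ∈ I, a ≤ s := by
    obtain ⟨a, ha⟩ := (I : Set ℝ).toFinite.bddBelow
    exact ⟨min a 0, min_le_right _ _, fun s hs => (min_le_left _ _).trans (ha hs)⟩
  have hm (b : ℝ) : Measurable fun (ω : PathSpace) (u : ℝ≥0) => ω.1 (u + b) - ω.1 b :=
    measurable_pi_lambda _ fun u => (hme _).sub (hme _)
  have hlaw : P.map (fun (ω : PathSpace) (u : ℝ≥0) => ω.1 (u + (a + t)) - ω.1 (a + t)) =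
      P.map fun (ω : PathSpace) (u : ℝ≥0) => ω.1 (u + a) - ω.1 a := by
    refine (map_eq_iff_forall_finset_map_restrict_eq (hm _).aemeasurable (hm _).aemeasurable).2
      fun J => ?_
    rw [((hP.isPreBrownianReal_shift (a + t)).hasLaw J).map_eq,
      ((hP.isPreBrownianReal_shift a).hasLaw J).map_eq]
  let Ψ (x : ℝ≥0 → ℝ) (s : I) : ℝ := x (s - a).toNNReal - x (-a).toNNReal
  have hΨ : Measurable Ψ := measurable_pi_lambda _ fun s =>
    (measurable_pi_apply _).sub (measurable_pi_apply _)
  have hcongr := congrArg (fun μ => μ.map Ψ) hlaw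
  simp only [Measure.map_map hΨ (hm _)] at hcongr
  have hcoe (s : I) : ((((s : ℝ) - a).toNNReal : ℝ≥0) : ℝ) = s - a :=
    Real.coe_toNNReal _ (sub_nonneg.2 (haI s s.2))
  have hcoe' : (((-a).toNNReal : ℝ≥0) : ℝ) = -a := Real.coe_toNNReal _ (neg_nonneg.2 ha0)
  convert hcongr using 2
  · ext ω s
    simp only [Function.comp_apply, Ψ, hcoe, hcoe', Finset.restrict]
    change ω.1 (s + t) - ω.1 t = _
    rw [show (s : ℝ) - a + (a + t) = s + t by ring, show -a + (a + t) = t by ring]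
    ring
  · ext ω s
    simp only [Function.comp_apply, Ψ, hcoe, hcoe', Finset.restrict, sub_add_cancel,
      neg_add_cancel, ω.2]
    ring

lemma ae_mem_temperedPaths (hP : IsWienerMeasure P) : ∀ᵐ ω ∂P, ω ∈ temperedPaths := by
  have hme (s : ℝ) : Measurable fun ω : PathSpace => ω.1 s := (continuous_pathEval s).measurable
  have h1 := tendsto_abs_div_of_isPreBrownianReal (hP.isPreBrownianReal_shift 0)
    (fun t => (hme _).sub (hme _)) (fun ω => by fun_prop) (fun ω => by simp)
  have h2 := tendsto_abs_div_of_isPreBrownianReal hP.isPreBrownianReal_neg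
    (fun t => hme _) (fun ω => by fun_prop) (fun ω => by simp [ω.2])
  filter_upwards [h1, h2] with ω hω1 hω2
  refine ⟨(hω1.comp Real.tendsto_toNNReal_atTop).congr' ?_,
    (hω2.comp (Real.tendsto_toNNReal_atTop.comp tendsto_neg_atBot_atTop)).congr' ?_⟩
  · filter_upwards [eventually_ge_atTop 0] with t ht
    simp [Real.coe_toNNReal _ ht, ω.2, abs_of_nonneg ht]
  · filter_upwards [eventually_le_atBot 0] with t ht
    simp [Real.coe_toNNReal _ (neg_nonneg.2 ht), abs_of_nonpos ht]

lemma measure_temperedPaths (hP : IsWienerMeasure P) : P temperedPaths = 1 := by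
  have hprob := hP.isProbabilityMeasure
  exact (mem_ae_iff_prob_eq_one measurableSet_temperedPaths).1 hP.ae_mem_temperedPaths

lemma isMetricDS (hP : IsWienerMeasure P) : IsMetricDS shift (P.comap Subtype.val) := by
  have hemb : MeasurableEmbedding (Subtype.val : Tempered → PathSpace) :=
    MeasurableEmbedding.subtype_coe measurableSet_temperedPaths
  have hmap : (P.comap (Subtype.val : Tempered → PathSpace)).map Subtype.val = P := by
    rw [hemb.map_comap, Subtype.range_coe]
    exact Measure.restrict_eq_self_of_ae_mem hP.ae_mem_temperedPaths
  have hms : Measurable fun p : ℝ × Tempered => shift p.1 p.2 := continuous_shift.measurable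
  refine ⟨⟨?_⟩, isGroupOfMaps_shift, hms, fun t => ?_⟩
  · rw [hemb.comap_apply, image_univ, Subtype.range_coe, hP.measure_temperedPaths]
  · have hmt : Measurable (shift t) := hms.comp (measurable_const.prodMk measurable_id)
    have hwt : Measurable (wienerShift t) :=
      (continuous_wienerShift.comp (continuous_const.prodMk continuous_id)).measurable
    rw [← hemb.comap_map ((P.comap Subtype.val).map (shift t)),
      Measure.map_map measurable_subtype_coe hmt]
    change (Measure.map (wienerShift t ∘ Subtype.val) _).comap _ = _
    rw [← Measure.map_map hwt measurable_subtype_coe, hmap, hP.map_wienerShift]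

end IsWienerMeasure

/-! ### The Ornstein–Uhlenbeck path -/

/-- Sublinear growth controls both tails and compactness the middle. This linear bound supplies the
integrable majorants for `ouZ`. -/
lemma exists_abs_le_mul (ω : Tempered) : ∃ C, 0 ≤ C ∧ ∀ t, |ω.1.1 t| ≤ C * (1 + |t|) := by
  have hlt : ∀ {l : Filter ℝ}, Tendsto (fun t => |ω.1.1 t| / |t|) l (𝓝 0) → (∀ᶠ t in l, t ≠ 0) →
      ∀ᶠ t in l, |ω.1.1 t| ≤ |t| := fun h h0 => by
    filter_upwards [h.eventually_lt_const one_pos, h0] with t ht ht0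
    rw [div_lt_one (abs_pos.2 ht0)] at ht
    exact ht.le
  obtain ⟨b, hb⟩ := eventually_atTop.1 (hlt ω.2.1 (eventually_ne_atTop 0))
  obtain ⟨a, ha⟩ := eventually_atBot.1 (hlt ω.2.2 (eventually_ne_atBot 0))
  obtain ⟨C, hC⟩ := isCompact_Icc.exists_bound_of_continuousOn
    (ω.1.1.continuous.continuousOn (s := Icc a b))
  have hmax : 0 ≤ max C 1 := le_max_of_le_right zero_le_one
  refine ⟨max C 1, hmax, fun t => ?_⟩
  have h1 : |t| ≤ max C 1 * (1 + |t|) := by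
    nlinarith [abs_nonneg t, le_max_right C 1]
  rcases le_total t a with h | h
  · exact (ha t h).trans h1
  · rcases le_total b t with h' | h'
    · exact (hb t h').trans h1
    · refine (hC t ⟨h, h'⟩).trans ((le_max_left C 1).trans ?_)
      nlinarith [abs_nonneg t]

lemma integrableOn_exp_mul_one_add_abs :
    IntegrableOn (fun r : ℝ => Real.exp r * (1 + |r|)) (Iic 0) := by
  have hdom : IntegrableOn (fun r : ℝ => 2 * Real.exp (1 / 2 * r)) (Iic 0) :=
    (integrableOn_exp_mul_Iic (by norm_num) 0).const_mul 2
  refine hdom.mono' (Continuous.aestronglyMeasurable (by fun_prop)) ?_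
  filter_upwards [ae_restrict_mem measurableSet_Iic] with r hr
  have hr' : r ≤ 0 := hr
  -- For `r ≤ 0` this gives `1 + |r| ≤ 2 e^{-r/2}`, leaving the integrable factor `e^{r/2}`.
  have h1 := Real.add_one_le_exp (-r / 2)
  have h2 : Real.exp r * Real.exp (-r / 2) = Real.exp (1 / 2 * r) := by
    rw [← Real.exp_add]; ring_nf
  rw [Real.norm_of_nonneg (by positivity), abs_of_nonpos hr', ← h2]
  nlinarith [Real.exp_pos r]

lemma integrableOn_exp_mul_path (ω : Tempered) :
    IntegrableOn (fun r : ℝ => Real.exp r * ω.1.1 r) (Iic 0) := by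
  obtain ⟨C, -, hC⟩ := exists_abs_le_mul ω
  refine (integrableOn_exp_mul_one_add_abs.const_mul C).mono'
    (Continuous.aestronglyMeasurable (by fun_prop)) (ae_of_all _ fun r => ?_)
  rw [Real.norm_eq_abs, abs_mul, abs_of_pos (Real.exp_pos r)]
  calc Real.exp r * |ω.1.1 r| ≤ Real.exp r * (C * (1 + |r|)) := by gcongr; exact hC r
    _ = _ := by ring

lemma continuous_ouZ_shift (ω : Tempered) : Continuous fun t => ouZ (shift t ω) := by
  obtain ⟨C, hC0, hC⟩ := exists_abs_le_mul ω
  refine continuous_iff_continuousAt.2 fun t₀ => ContinuousAt.neg ?_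
  refine continuousAt_of_dominated
    -- For `|t - t₀| < 1`, `(1 + |r + t|) + (1 + |t|) ≤ 4 + |r| + 2 |t₀|`, which gives a majorant
    -- independent of `t`.
    (bound := fun r => (C * (4 + 2 * |t₀|)) * (Real.exp r * (1 + |r|)))
    (Eventually.of_forall fun t => Continuous.aestronglyMeasurable (by fun_prop)) ?_
    (integrableOn_exp_mul_one_add_abs.const_mul _) (ae_of_all _ fun r => ?_)
  · filter_upwards [Metric.ball_mem_nhds t₀ one_pos] with t ht
    refine ae_of_all _ fun r => ?_
    rw [Metric.mem_ball, Real.dist_eq] at ht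
    have ht' : |t| ≤ |t₀| + 1 := by
      have := abs_sub_abs_le_abs_sub t t₀
      linarith
    rw [Real.norm_eq_abs, abs_mul, abs_of_pos (Real.exp_pos r)]
    have h1 : |ω.1.1 (r + t) - ω.1.1 t| ≤ C * (4 + 2 * |t₀|) * (1 + |r|) := by
      refine (abs_sub _ _).trans ((add_le_add (hC _) (hC _)).trans ?_)
      rw [← mul_add, mul_assoc]
      refine mul_le_mul_of_nonneg_left ?_ hC0
      nlinarith [abs_add_le r t, abs_nonneg r, abs_nonneg t₀, mul_nonneg (abs_nonneg r)
        (abs_nonneg t₀)]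
    calc Real.exp r * |(shift t ω).1.1 r| ≤ Real.exp r * (C * (4 + 2 * |t₀|) * (1 + |r|)) := by
          gcongr; exact h1
      _ = _ := by ring
  · exact ((Continuous.continuousAt (by fun_prop) :
      ContinuousAt (fun t => ω.1.1 (r + t) - ω.1.1 t) t₀)).const_mul _

lemma measurable_ouZ : Measurable ouZ := by
  have hc : Continuous fun p : Tempered × ℝ => Real.exp p.2 * p.1.1.1 p.2 :=
    (Real.continuous_exp.comp continuous_snd).mul (continuous_eval.comp
      ((continuous_subtype_val.comp (continuous_subtype_val.comp continuous_fst)).prodMk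
        continuous_snd))
  exact (hc.measurable.stronglyMeasurable.integral_prod_right'
    (ν := volume.restrict (Iic (0 : ℝ)))).measurable.neg

/-- The Ornstein–Uhlenbeck path `t ↦ z(θ_t ω)`. -/
noncomputable def ouPath (ω : Tempered) : C(ℝ, ℝ) :=
  ⟨fun t => ouZ (shift t ω), continuous_ouZ_shift ω⟩

lemma measurable_ouPath : Measurable[_, borel C(ℝ, ℝ)] ouPath :=
  measurable_of_forall_eval fun _ => measurable_ouZ.comp
    (continuous_shift.measurable.comp (measurable_const.prodMk measurable_id))

/-! ### The cocycle -/

namespace IsAdmissible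

variable {ν lam : ℤ → ℝ → ℝ} {f : ℤ → ℝ → ℝ → ℝ} {c β : ℝ}

/-- Solutions depend measurably on the Wiener path and the initial value. -/
lemma measurable_solution (h : IsAdmissible ν lam f c β) {τ t : ℝ} (ht : τ ≤ t) (g : ℝ →ᵇ EllTwo)
    {α : Type*} {m : MeasurableSpace α} {ω : α → Tempered} {x : α → EllTwo} (hω : Measurable ω)
    (hx : Measurable x) : Measurable fun a => solution ν lam f (ouPath (ω a)) g τ (x a) t := by
  borelize C(ℝ, ℝ)
  have hc : Continuous fun p : C(ℝ, ℝ) × EllTwo => solution ν lam f p.1 g τ p.2 t :=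
    (h.continuous_solution ht).comp
      (continuous_fst.prodMk (continuous_snd.prodMk continuous_const))
  exact hc.measurable.comp ((measurable_ouPath.comp hω).prodMk hx)

theorem isContinuousCocycle_solution (h : IsAdmissible ν lam f c β) {P : Measure PathSpace}
    (hP : IsWienerMeasure P) (g : ℝ →ᵇ EllTwo) :
    IsContinuousCocycle (fun t τ : ℝ => τ + t) shift (P.comap Subtype.val)
      fun (t : ℝ≥0) (τ : ℝ) (ω : Tempered) (v₀ : EllTwo) =>
        solution ν lam f (ouPath (shift (-τ) ω)) g τ v₀ (t + τ) := by
  have hz (ω : Tempered) : Continuous (ouPath ω) := (ouPath ω).continuous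
  have hle (t : ℝ≥0) (τ : ℝ) : τ ≤ t + τ := le_add_of_nonneg_left t.2
  have hshift (t : ℝ) : Measurable (shift t) :=
    continuous_shift.measurable.comp (measurable_const.prodMk measurable_id)
  refine ⟨⟨fun τ => add_zero τ, fun s t τ => (add_assoc τ s t).symm⟩, hP.isMetricDS,
    fun τ => ?_, fun τ ω x => ?_, fun t s τ ω x => ?_, fun t τ ω => ?_⟩
  -- Joint measurability is that of a Carathéodory function: continuous in time, measurable in path
  -- and state.
  · refine measurable_uncurry_of_continuous_of_measurable
      (u := fun (t : ℝ≥0) (p : Tempered × EllTwo) =>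
        solution ν lam f (ouPath (shift (-τ) p.1)) g τ p.2 (t + τ)) (fun p => ?_) fun t => ?_
    · exact (h.isCoordSolution_solution (hz _) g.continuous τ p.2).1.comp_continuous
        (by fun_prop) fun t => hle t τ
    · exact h.measurable_solution (hle t τ) g ((hshift (-τ)).comp measurable_fst) measurable_snd
  · simpa using h.solution_self (hz _) g.continuous τ x
  -- Both sides of the cocycle law are driven by the same noise path, so the law reduces to
  -- restarting the solution at time `s + τ`.
  · have e : shift (-(τ + s)) (shift s ω) = shift (-τ) ω := by
      rw [← isGroupOfMaps_shift.add]
      congr 1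
      ring
    simp only [e]
    rw [add_comm τ (s : ℝ), ← h.solution_solution (hz _) g.continuous (hle s τ) (hle t (s + τ)),
      NNReal.coe_add, add_assoc]
  · exact (h.continuous_solution (hle t τ)).comp
      (continuous_const.prodMk (continuous_id.prodMk continuous_const))

end IsAdmissible

end LatticeRDE

open LatticeRDE
theorem mainTheorem4 (ν lam : ℤ → ℝ → ℝ) (f : ℤ → ℝ → ℝ → ℝ)
    (hA1 : AssumptionA1 ν lam) (hA2 : AssumptionA2 f) (hA3 : AssumptionA3 f)
    (P : Measure PathSpace) (hP : IsWienerMeasure P) :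
    -- the paths considered form a measurable set of full measure on which `z(θ_t ω)` makes sense
    (MeasurableSet temperedPaths ∧ P temperedPaths = 1 ∧
      ∀ ω : Tempered, IntegrableOn (fun r : ℝ => Real.exp r * ω.1.1 r) (Iic 0) ∧
        Continuous (fun t : ℝ => ouZ (shift t ω))) ∧
    -- the solution map `v t τ ω v₀ g`
    ∃ v : ℝ → ℝ → Tempered → EllTwo → (ℝ →ᵇ EllTwo) → EllTwo,
      -- existence and uniqueness on `[τ, τ + T)` for every `T > 0`, and on `[τ, ∞)`
      (∀ (τ : ℝ) (ω : Tempered) (v₀ : EllTwo) (g : ℝ →ᵇ EllTwo),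
        (∀ T : ℝ, 0 < T →
          IsMildSolution (latticeField ν lam f g) τ ω v₀ (Ico τ (τ + T))
            (fun t => v t τ ω v₀ g) ∧
          ∀ w : ℝ → EllTwo,
            IsMildSolution (latticeField ν lam f g) τ ω v₀ (Ico τ (τ + T)) w →
              EqOn w (fun t => v t τ ω v₀ g) (Ico τ (τ + T))) ∧
        IsMildSolution (latticeField ν lam f g) τ ω v₀ (Ici τ) (fun t => v t τ ω v₀ g) ∧
        ∀ w : ℝ → EllTwo,
          IsMildSolution (latticeField ν lam f g) τ ω v₀ (Ici τ) w →
            EqOn w (fun t => v t τ ω v₀ g) (Ici τ)) ∧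
      -- measurability in `ω`
      (∀ (τ t : ℝ), τ ≤ t → ∀ (v₀ : EllTwo) (g : ℝ →ᵇ EllTwo),
        Measurable (fun ω : Tempered => v t τ ω v₀ g)) ∧
      -- continuity in the initial value and in the forcing
      (∀ (τ t : ℝ), τ ≤ t → ∀ ω : Tempered,
        Continuous (fun p : EllTwo × (ℝ →ᵇ EllTwo) => v t τ ω p.1 p.2)) ∧
      -- the continuous cocycle, and its form in the original variable
      ∀ g : ℝ →ᵇ EllTwo,
        IsContinuousCocycle (fun t τ : ℝ => τ + t) shift (P.comap Subtype.val)
          (fun (t : ℝ≥0) (τ : ℝ) (ω : Tempered) (v₀ : EllTwo) =>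
            v (t + τ) τ (shift (-τ) ω) v₀ g) ∧
        ∀ (t : ℝ≥0) (τ : ℝ) (ω : Tempered) (u₀ : EllTwo),
          v (t + τ) τ (shift (-τ) ω) (Real.exp (-ouZ ω) • u₀) g =
            Real.exp (-ouZ (shift t ω)) •
              originalSolution v (t + τ) τ (shift (-τ) ω) u₀ g := by
  obtain ⟨c, β, h⟩ := exists_isAdmissible hA1 hA2 hA3
  have hg (g : ℝ →ᵇ EllTwo) : Continuous g := g.continuous
  have hz (ω : Tempered) : Continuous (ouPath ω) := (ouPath ω).continuous
  refine ⟨⟨measurableSet_temperedPaths, hP.measure_temperedPaths, fun ω =>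
    ⟨integrableOn_exp_mul_path ω, continuous_ouZ_shift ω⟩⟩,
    fun t τ ω v₀ g => solution ν lam f (ouPath ω) g τ v₀ t, fun τ ω v₀ g => ?_,
    fun τ t ht v₀ g => h.measurable_solution ht g measurable_id measurable_const,
    fun τ t ht ω => (h.continuous_solution ht).comp (continuous_const.prodMk continuous_id),
    fun g => ⟨h.isContinuousCocycle_solution hP g, fun t τ ω u₀ => ?_⟩⟩
  -- Along a fixed `ω`, `latticeField` unfolds to `coordField` with noise path `ouPath ω`, so the
  -- two notions of solution agree by definition.
  · have hsol : IsMildSolution (latticeField ν lam f g) τ ω v₀ (Ici τ)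
        (solution ν lam f (ouPath ω) g τ v₀) := h.isCoordSolution_solution (hz ω) (hg g) τ v₀
    refine ⟨fun T _ => ⟨IsCoordSolution.mono hsol Ico_subset_Ici_self, fun w hw t ht => ?_⟩,
      hsol, fun w hw t ht => ?_⟩
    · exact h.eq_solution (hz ω) (hg g) ht.1
        (IsCoordSolution.mono hw fun s hs => ⟨hs.1, hs.2.trans_lt ht.2⟩)
    · exact h.eq_solution (hz ω) (hg g) ht (IsCoordSolution.mono hw Icc_subset_Ici_self)
  · have e1 : shift τ (shift (-τ) ω) = ω := by
      rw [← isGroupOfMaps_shift.add, neg_add_cancel, isGroupOfMaps_shift.zero]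
    have e2 : shift (t + τ) (shift (-τ) ω) = shift t ω := by
      rw [← isGroupOfMaps_shift.add, neg_add_cancel_comm_assoc]
    rw [originalSolution, e1, e2, smul_smul, ← Real.exp_add, neg_add_cancel, Real.exp_zero,
      one_smul]
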